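/- Let $s\ge 1$ and let $M$ be an integer $s\times s$ dilation matrix, i.e. $\det M\neq 0$ and $\rho(M^{-1})<1$. Let $E$ be a complete set of representatives of $\mathbb Z^s/M\mathbb Z^s$, let $N\in\mathbb N_0$, and let $G\subset\mathbb Z^s$ be any finite set containing $\{0,\dots,N\}^s-E$ (for $M=mI$, $m\ge 2$, $E=\{0,\dots,m-1\}^s$ one may take $G=\{-m,\dots,N+1\}^s$). All masks are real sequences on $\mathbb Z^s$ supported in $\{0,\dots,N\}^s$. The subdivision operator of a mask $\mathbf a$ is $S_{\mathbf a}\mathbf c(\alpha)=\sum_{\beta\in\mathbb Z^s}\mathbf a(\alpha-M\beta)c(\beta)$; a non-stationary scheme $\{S_{\mathbf a^{(k)}},k\ge1\}$ is given by a sequence of masks. A *test function* is a continuous compactly supported $f:\mathbb R^s\to\mathbb R$ which is stable (there are $0<C_1\le C_2<\infty$ with $C_1\|\mathbf c\|_{\ell_\infty}\le\|\sum_\alpha c(\alpha)f(\cdot-\alpha)\|_\infty\le C_2\|\mathbf c\|_{\ell_\infty}$ for all $\mathbf c\in\ell_\infty(\mathbb Z^s)$) and satisfies $\hat f(0)=1$,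 $\hat f(\alpha)=0$ for $\alpha\in\mathbb Z^s\setminus\{0\}$, where $\hat f(\xi)=\int f(x)e^{-2\pi i x\cdot\xi}dx$. The scheme is *$C^0$-convergent* if for every $\mathbf c\in\ell_\infty(\mathbb Z^s)$ there is a continuous $g_{\mathbf c}:\mathbb R^s\to\mathbb R$ such that for every test function $f$ $$\lim_{k\to\infty}\Big\|g_{\mathbf c}-\sum_{\alpha\in\mathbb Z^s}\big(S_{\mathbf a^{(k)}}\cdots S_{\mathbf a^{(1)}}\mathbf c\big)(\alpha)\,f(M^k\cdot-\alpha)\Big\|_\infty=0 .$$ The *set of limit points* of a mask sequence is the set of limits of its convergent subsequences; two schemes are *asymptotically similar* if their sets of limit points coincide. With the symbol $a_*(z)=\sum_\alpha \mathbf a(\alpha)z^\alpha$ and $\Xi=\{e^{2\pi i M^{-T}\xi}:\xi\in\mathbb Z^s\}$ (a finite set), the masks $\mathbf a^{(k)}$ satisfy *approximate sum rules of order 1* if $$\sum_{k\ge1}\big|a^{(k)}_*(1)-|\det M|\big|<\infty\quad\text{and}\quad \sum_{k\ge1}\max_{\epsilon\in\Xi\setminus\{1\}}|a_*^{(k)}(\epsilon)|<\infty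 .$$ Let $K=\mathbb Z^s\cap\{\sum_{r\ge1}M^{-r}g_r: g_r\in G\}$ (a finite set), $T_{\varepsilon,\mathbf a}=[\mathbf a(\varepsilon+M\alpha-\beta)]_{\alpha,\beta\in K}$ for $\varepsilon\in E$, and $V_0=\{v\in\mathbb R^{K}:\sum_{\alpha\in K}v_\alpha=0\}$. For a set $\mathcal A$ of masks let $\mathcal T_{\mathcal A}|_{V_0}=\{T_{\varepsilon,\mathbf a}|_{V_0}:\varepsilon\in E,\ \mathbf a\in\mathcal A\}$, where $T_{\varepsilon,\mathbf a}|_{V_0}$ is regarded as an endomorphism of $V_0$ (if $T_{\varepsilon,\mathbf a}$ leaves $V_0$ invariant, which under the hypotheses below is always the case for the limit points), and let $\rho(\mathcal M)=\lim_{n\to\infty}\sup_{M_1,\dots,M_n\in\mathcal M}\|M_1\cdots M_n\|^{1/n}$ denote the joint spectral radius. **Corollary 2.** Let $\{S_{\mathbf a^{(k)}},k\ge1\}$ be a $C^0$-convergent scheme with set of limit points $\mathcal A$ such that $\rho(\mathcal T_{\mathcal A}|_{V_0})<1$. Then every scheme $\{S_{\mathbf b^{(k)}},k\ge1\}$ whose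 masks are uniformly bounded ($\sup_{k,\alpha}|\mathbf b^{(k)}(\alpha)|<\infty$), which is asymptotically similar to $\{S_{\mathbf a^{(k)}},k\ge1\}$ and satisfies approximate sum rules of order 1, is $C^0$-convergent. -/

import Mathlib

open Filter Topology MeasureTheory
open scoped ENNReal Matrix

namespace NonstationarySubdivision

/-! ### Dilation matrices, masks, subdivision operators -/

/-- The integer matrix `M` regarded as a real matrix. -/
def realMat {s : ℕ} (M : Matrix (Fin s) (Fin s) ℤ) : Matrix (Fin s) (Fin s) ℝ :=
  M.map (Int.cast : ℤ → ℝ)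

/-- The lattice point `α ∈ ℤ^s` regarded as a point of `ℝ^s`. -/
def realVec {s : ℕ} (α : Fin s → ℤ) : Fin s → ℝ := fun i => (α i : ℝ)

/-- `M` is an integer dilation matrix: `M` is invertible over the reals and `ρ(M⁻¹) < 1`
(the spectral radius is computed over `ℂ`). -/
def IsDilation {s : ℕ} (M : Matrix (Fin s) (Fin s) ℤ) : Prop :=
  M.det ≠ 0 ∧ spectralRadius ℂ (M.map (Int.cast : ℤ → ℂ))⁻¹ < 1

/-- `E` is a complete set of representatives of `ℤ^s / M ℤ^s`. -/
def IsCosetReps {s : ℕ} (M : Matrix (Fin s) (Fin s) ℤ) (E : Finset (Fin s → ℤ)) : Prop :=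
  ∀ x : Fin s → ℤ, ∃! ε : Fin s → ℤ, ε ∈ E ∧ ∃ y : Fin s → ℤ, x = ε + M *ᵥ y

/-- Real masks `a = {a(α), α ∈ ℤ^s}`. -/
abbrev Mask (s : ℕ) : Type := (Fin s → ℤ) → ℝ

/-- The cube `{0, …, N}^s`. -/
def cube (s N : ℕ) : Set (Fin s → ℤ) := {α | ∀ i, 0 ≤ α i ∧ α i ≤ (N : ℤ)}

/-- The mask is supported in `{0, …, N}^s`. -/
def Mask.SupportedIn {s : ℕ} (a : Mask s) (N : ℕ) : Prop := ∀ α, α ∉ cube s N → a α = 0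

/-- The subdivision operator `(S_a c)(α) = ∑_β a(α - Mβ) c(β)`
(a finite sum for masks of finite support and invertible `M`). -/
noncomputable def subdivision {s : ℕ} (M : Matrix (Fin s) (Fin s) ℤ) (a : Mask s)
    (c : (Fin s → ℤ) → ℝ) : (Fin s → ℤ) → ℝ :=
  fun α => ∑' β : Fin s → ℤ, a (α - M *ᵥ β) * c β

/-- Level-dependent masks are given as a sequence `a : ℕ → Mask s`, where `a k` is the mask
`a^{(k+1)}` of level `k + 1`. The data after `k` steps is
`S_{a^{(k)}} ⋯ S_{a^{(1)}} c`. -/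
noncomputable def iterate {s : ℕ} (M : Matrix (Fin s) (Fin s) ℤ) (a : ℕ → Mask s)
    (c : (Fin s → ℤ) → ℝ) : ℕ → (Fin s → ℤ) → ℝ
  | 0 => c
  | k + 1 => subdivision M (a k) (iterate M a c k)

/-! ### `C^0`-convergence -/

/-- Bounded sequences on `ℤ^s`, i.e. elements of `ℓ_∞(ℤ^s)`. -/
def IsBoundedSeq {s : ℕ} (c : (Fin s → ℤ) → ℝ) : Prop := ∃ C : ℝ, ∀ α, |c α| ≤ C

/-- The Fourier transform `∫ e^{-2πi x·ξ} f(x) dx` of an integrable function on `ℝ^s`. -/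
noncomputable def fourier {s : ℕ} (f : (Fin s → ℝ) → ℝ) (ξ : Fin s → ℝ) : ℂ :=
  ∫ x : Fin s → ℝ,
    Complex.exp (-(2 * (Real.pi : ℂ) * Complex.I * ((x ⬝ᵥ ξ : ℝ) : ℂ))) * (f x : ℂ)

/-- Stability of `f`:
`C₁ ‖c‖_∞ ≤ ‖∑_α c(α) f(· - α)‖_{L_∞} ≤ C₂ ‖c‖_∞` for all bounded sequences `c`. -/
def IsStable {s : ℕ} (f : (Fin s → ℝ) → ℝ) : Prop :=
  ∃ C₁ C₂ : ℝ, 0 < C₁ ∧ C₁ ≤ C₂ ∧ ∀ c : (Fin s → ℤ) → ℝ, IsBoundedSeq c →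
    ENNReal.ofReal C₁ * (⨆ α, ‖c α‖ₑ) ≤
        eLpNorm (fun x : Fin s → ℝ => ∑' α : Fin s → ℤ, c α * f (x - realVec α)) ∞ volume ∧
      eLpNorm (fun x : Fin s → ℝ => ∑' α : Fin s → ℤ, c α * f (x - realVec α)) ∞ volume ≤
        ENNReal.ofReal C₂ * (⨆ α, ‖c α‖ₑ)

/-- Test functions for `C^0`-convergence: continuous, compactly supported, stable functions
that satisfy the Strang-Fix conditions of order `1`. -/
structure IsTestFunction {s : ℕ} (f : (Fin s → ℝ) → ℝ) : Prop where
  continuous : Continuous f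
  hasCompactSupport : HasCompactSupport f
  stable : IsStable f
  fourier_zero : fourier f 0 = 1
  fourier_lattice : ∀ α : Fin s → ℤ, α ≠ 0 → fourier f (realVec α) = 0

/-- `C^0`-convergence of the scheme with masks `a`: for every bounded initial sequence `c` there
is a continuous `g` such that for every test function `f` the functions
`∑_α (S_{a^{(k)}} ⋯ S_{a^{(1)}} c)(α) f(M^k · - α)` converge to `g` uniformly on `ℝ^s`. -/
def C0Convergent {s : ℕ} (M : Matrix (Fin s) (Fin s) ℤ) (a : ℕ → Mask s) : Prop :=
  ∀ c : (Fin s → ℤ) → ℝ, IsBoundedSeq c →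
    ∃ g : (Fin s → ℝ) → ℝ, Continuous g ∧
      ∀ f : (Fin s → ℝ) → ℝ, IsTestFunction f →
        TendstoUniformly
          (fun (k : ℕ) (x : Fin s → ℝ) =>
            ∑' α : Fin s → ℤ, iterate M a c k α * f ((realMat M) ^ k *ᵥ x - realVec α))
          g atTop

/-! ### Limit points and asymptotic similarity -/

/-- The set of limit points of a sequence of masks, i.e. of limits of its subsequences.
(For masks with supports in a fixed finite set, the pointwise convergence used here is
convergence in norm.) -/
def limitPoints {s : ℕ} (a : ℕ → Mask s) : Set (Mask s) :=
  {x | ∃ φ : ℕ → ℕ, StrictMono φ ∧ Tendsto (fun n => a (φ n)) atTop (𝓝 x)}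

/-- Two schemes are asymptotically similar if their sets of limit points coincide. -/
def AsymptoticallySimilar {s : ℕ} (a b : ℕ → Mask s) : Prop := limitPoints a = limitPoints b

/-! ### Approximate sum rules of order `1` -/

/-- The symbol `a_*(z) = ∑_α a(α) z^α`. -/
noncomputable def symbol {s : ℕ} (a : Mask s) (z : Fin s → ℂ) : ℂ :=
  ∑' α : Fin s → ℤ, (a α : ℂ) * ∏ j, z j ^ α j

/-- The finite set `Ξ = {e^{2πi M^{-T} ξ}}`; the point depends only on the coset
`ξ + M^T ℤ^s`, so that `ξ` may run through all of `ℤ^s`. -/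
noncomputable def Xi {s : ℕ} (M : Matrix (Fin s) (Fin s) ℤ) : Set (Fin s → ℂ) :=
  Set.range fun (ξ : Fin s → ℤ) (j : Fin s) =>
    Complex.exp (2 * (Real.pi : ℂ) * Complex.I * ((((realMat M)ᵀ⁻¹ *ᵥ realVec ξ) j : ℝ) : ℂ))

/-- `μ = |a_*(1) - |det M||`. -/
noncomputable def normalizationDefect {s : ℕ} (M : Matrix (Fin s) (Fin s) ℤ) (a : Mask s) : ℝ :=
  ‖symbol a 1 - ((|M.det| : ℤ) : ℂ)‖

/-- `δ = max_{ε ∈ Ξ \ {1}} |a_*(ε)|`. -/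
noncomputable def sumRuleDefect {s : ℕ} (M : Matrix (Fin s) (Fin s) ℤ) (a : Mask s) : ℝ :=
  sSup ((fun z => ‖symbol a z‖) '' (Xi M \ {1}))

/-- Approximate sum rules of order `1`: the defects `μ_k` and `δ_k` are summable. -/
def ApproxSumRules {s : ℕ} (M : Matrix (Fin s) (Fin s) ℤ) (a : ℕ → Mask s) : Prop :=
  (Summable fun k => normalizationDefect M (a k)) ∧ Summable fun k => sumRuleDefect M (a k)

/-! ### The index set `K`, transition matrices, joint spectral radius -/

/-- The lattice points of `∑_{r ≥ 1} M^{-r} G = {∑_{r ≥ 1} M^{-r} g_r : g_r ∈ G}`. -/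
def attractorPoints {s : ℕ} (M : Matrix (Fin s) (Fin s) ℤ) (G : Finset (Fin s → ℤ)) :
    Set (Fin s → ℤ) :=
  {α | ∃ g : ℕ → Fin s → ℤ, (∀ r, g r ∈ G) ∧
    HasSum (fun r => (realMat M)⁻¹ ^ (r + 1) *ᵥ realVec (g r)) (realVec α)}

theorem summable_norm_inv_pow_mulVec {s : ℕ} {M : Matrix (Fin s) (Fin s) ℤ}
    (hM : IsDilation M) :
    ∃ u : ℕ → ℝ, Summable u ∧ ∀ (r : ℕ) (v : Fin s → ℝ),
      ‖(realMat M)⁻¹ ^ (r + 1) *ᵥ v‖ ≤ u r * ‖v‖ := by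
  let _ : NormedRing (Matrix (Fin s) (Fin s) ℂ) := Matrix.linftyOpNormedRing
  let _ : NormedAlgebra ℂ (Matrix (Fin s) (Fin s) ℂ) := Matrix.linftyOpNormedAlgebra
  let _ : NormedRing (Matrix (Fin s) (Fin s) ℝ) := Matrix.linftyOpNormedRing
  have _ : CompleteSpace (Matrix (Fin s) (Fin s) ℂ) := FiniteDimensional.complete ℂ _
  obtain ⟨hdet, hsp⟩ := hM
  set A : Matrix (Fin s) (Fin s) ℂ := (M.map (Int.cast : ℤ → ℂ))⁻¹ with hA
  have hBA : (realMat M)⁻¹.map (Complex.ofRealHom : ℝ →+* ℂ) = A := by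
    rw [hA]
    symm
    apply Matrix.inv_eq_right_inv
    have h1 : M.map (Int.cast : ℤ → ℂ)
        = (realMat M).map (Complex.ofRealHom : ℝ →+* ℂ) := by
      ext i j
      simp [realMat]
    have h2 : IsUnit (realMat M).det := by
      have : (realMat M).det = (M.det : ℝ) := by
        have := (Int.castRingHom ℝ).map_det M
        simpa [realMat] using this.symm
      rw [this, isUnit_iff_ne_zero]
      exact_mod_cast hdet
    rw [h1, ← Matrix.map_mul, Matrix.mul_nonsing_inv _ h2]
    simp
  have hnorm : ∀ n : ℕ, ‖(realMat M)⁻¹ ^ n‖ = ‖A ^ n‖ := by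
    intro n
    have h3 : A ^ n = ((realMat M)⁻¹ ^ n).map (Complex.ofRealHom : ℝ →+* ℂ) := by
      rw [← hBA]
      exact ((Complex.ofRealHom.mapMatrix).map_pow ((realMat M)⁻¹) n).symm
    rw [h3, Matrix.linfty_opNorm_def, Matrix.linfty_opNorm_def]
    simp
  obtain ⟨q, hq1, hq2⟩ := ENNReal.lt_iff_exists_nnreal_btwn.1 hsp
  have hq2' : q < 1 := by exact_mod_cast hq2
  have hev : ∀ᶠ n : ℕ in atTop, ‖A ^ n‖ ≤ (q : ℝ) ^ n := by
    have h4 := (spectrum.pow_nnnorm_pow_one_div_tendsto_nhds_spectralRadius A).eventually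
      (gt_mem_nhds hq1)
    filter_upwards [h4, eventually_gt_atTop 0] with n hn hn0
    have hn' : (‖A ^ n‖₊ : ℝ≥0∞) ≤ (q : ℝ≥0∞) ^ (n : ℝ) := by
      have h5 := ENNReal.rpow_le_rpow hn.le (Nat.cast_nonneg n : (0 : ℝ) ≤ n)
      rwa [← ENNReal.rpow_mul, one_div,
        inv_mul_cancel₀ (by positivity : (n : ℝ) ≠ 0), ENNReal.rpow_one] at h5
    rw [ENNReal.rpow_natCast] at hn'
    exact_mod_cast hn'
  refine ⟨fun r => ‖A ^ (r + 1)‖, ?_, fun r v => ?_⟩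
  · rw [summable_nat_add_iff (f := fun n => ‖A ^ n‖) 1]
    refine Summable.of_norm_bounded_eventually_nat
      (summable_geometric_of_lt_one q.2 (by exact_mod_cast hq2')) ?_
    filter_upwards [hev] with n hn
    simpa using hn
  · simp only [← hnorm]
    exact Matrix.linfty_opNorm_mulVec _ _

/-- There are finitely many such lattice points. -/
theorem attractorPoints_finite {s : ℕ} {M : Matrix (Fin s) (Fin s) ℤ} (hM : IsDilation M)
    (G : Finset (Fin s → ℤ)) : (attractorPoints M G).Finite := by
  obtain ⟨u, hu, hub⟩ := summable_norm_inv_pow_mulVec hM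
  obtain ⟨C, hC⟩ : ∃ C : ℝ, ∀ g ∈ G, ‖realVec g‖ ≤ C :=
    ⟨∑ g ∈ G, ‖realVec g‖, fun g hg =>
      Finset.single_le_sum (f := fun g => ‖realVec g‖) (fun _ _ => norm_nonneg _) hg⟩
  have hbound : ∀ α ∈ attractorPoints M G, ‖realVec α‖ ≤ ∑' r, |u r| * C := by
    rintro α ⟨g, hg, hsum⟩
    rw [← hsum.tsum_eq]
    refine tsum_of_norm_bounded (hu.abs.mul_right C).hasSum fun r => ?_
    calc _ ≤ u r * ‖realVec (g r)‖ := hub r _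
      _ ≤ |u r| * ‖realVec (g r)‖ := by gcongr; exact le_abs_self _
      _ ≤ |u r| * C := by gcongr; exact hC _ (hg r)
  refine (Set.finite_Icc (fun _ : Fin s => -⌈∑' r, |u r| * C⌉)
    (fun _ => ⌈∑' r, |u r| * C⌉)).subset fun α hα => ?_
  have h1 : ∀ i, |(α i : ℝ)| ≤ (⌈∑' r, |u r| * C⌉ : ℝ) := fun i =>
    ((norm_le_pi_norm (realVec α) i).trans (hbound α hα)).trans (Int.le_ceil _)
  exact ⟨fun i => by exact_mod_cast (abs_le.1 (h1 i)).1,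
    fun i => by exact_mod_cast (abs_le.1 (h1 i)).2⟩

/-- The finite index set `K = ℤ^s ∩ ∑_{r ≥ 1} M^{-r} G`. -/
noncomputable def indexSet {s : ℕ} {M : Matrix (Fin s) (Fin s) ℤ} (hM : IsDilation M)
    (G : Finset (Fin s → ℤ)) : Finset (Fin s → ℤ) :=
  (attractorPoints_finite hM G).toFinset

/-- The transition matrix `T_{ε,a} = [a(ε + Mα - β)]_{α,β ∈ K}`. -/
def transitionMatrix {s : ℕ} (M : Matrix (Fin s) (Fin s) ℤ) (K : Finset (Fin s → ℤ))
    (ε : Fin s → ℤ) (a : Mask s) : Matrix K K ℝ :=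
  Matrix.of fun α β => a (ε + M *ᵥ α.1 - β.1)

/-- The difference space `V_0 = {v ∈ ℝ^K : ∑_α v_α = 0}`. -/
def diffSpace {s : ℕ} (K : Finset (Fin s → ℤ)) : Submodule ℝ (K → ℝ) where
  carrier := {v | ∑ α, v α = 0}
  add_mem' := by
    intro v w hv hw
    simp only [Set.mem_ofPred_eq, Pi.add_apply, Finset.sum_add_distrib] at *
    rw [hv, hw, add_zero]
  zero_mem' := by simp
  smul_mem' := by
    intro t v hv
    simp only [Set.mem_ofPred_eq, Pi.smul_apply, smul_eq_mul, ← Finset.mul_sum] at *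
    rw [hv, mul_zero]

/-- The family `𝒯_𝒜|_{V_0} = {T_{ε,a}|_{V_0} : ε ∈ E, a ∈ 𝒜}` of endomorphisms of `V_0` that
are restrictions of transition matrices. (If the limit points of a scheme satisfy the sum rules of
order `1`, all the transition matrices leave `V_0` invariant and so have a restriction.) -/
def restrictedFamily {s : ℕ} (M : Matrix (Fin s) (Fin s) ℤ) (K E : Finset (Fin s → ℤ))
    (A : Set (Mask s)) : Set (diffSpace K →L[ℝ] diffSpace K) :=
  {L | ∃ ε ∈ E, ∃ a ∈ A, ∀ v : diffSpace K,
    (L v : K → ℝ) = transitionMatrix M K ε a *ᵥ (v : K → ℝ)}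

/-- The joint spectral radius
`lim_{n → ∞} sup_{M₁, …, M_n ∈ 𝓜} ‖M₁ ⋯ M_n‖^{1/n}`, as an extended nonnegative number; for
bounded `𝓜` the limit exists by submultiplicativity, so that it equals the `limsup`. -/
noncomputable def jointSpectralRadius {R : Type*} [NormedRing R] (𝓜 : Set R) : ℝ≥0∞ :=
  limsup (fun n : ℕ =>
    (⨆ w : Fin n → 𝓜, ‖(List.ofFn fun i => (w i : R)).prod‖ₑ) ^ (1 / (n : ℝ))) atTop

end NonstationarySubdivision

/-!
By Poisson summation, a test function `f` satisfies `∑_α f(x - α) = 1`, and by Fourier inversion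
on `ℤ^s / M ℤ^s` the sums of a mask over the cosets of `M ℤ^s` differ from `1` by at most the
defects in its sum rules. Hence limit points reproduce constants, and their transition matrices,
which map the differences of the data inside a window `x - K` to those of the subdivided data,
leave `V_0` invariant and contract an adapted norm on `V_0`. As almost all masks are close to
limit points, the sizes `C k` of the data and `D k` of their differences satisfy a coupled
recursion `C (k + 1) ≤ (1 + τ k) C k + Λ D k`, `D (k + 1) ≤ q D k + Λ' τ k C k` with `q < 1` and
`∑ τ k < ∞`, so that `C` is bounded and `D` is summable. The contractions `x ↦ M⁻¹ (g + x)` absorb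
every finite set of lattice points into `K`, which extends the summability of the differences to
all finite windows. Then the step functions `x ↦ c_k(⌊M^k x⌋)` converge uniformly, their limit is
continuous, and the partition of unity lets every test function replace the step functions.
-/

namespace NonstationarySubdivision

variable {s : ℕ}

/-! ### The lattice -/

@[simp]
theorem realVec_zero : realVec (0 : Fin s → ℤ) = 0 := by
  ext; simp [realVec]

theorem realVec_add (α β : Fin s → ℤ) : realVec (α + β) = realVec α + realVec β := by
  ext; simp [realVec]

theorem realVec_neg (α : Fin s → ℤ) : realVec (-α) = -realVec α := by
  ext; simp [realVec]

theorem realVec_sub (α β : Fin s → ℤ) : realVec (α - β) = realVec α - realVec β := by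
  ext; simp [realVec]

theorem isometry_realVec : Isometry (realVec : (Fin s → ℤ) → Fin s → ℝ) :=
  Isometry.of_dist_eq fun _ _ => rfl

theorem norm_realVec (α : Fin s → ℤ) : ‖realVec α‖ = ‖α‖ := rfl

theorem finite_norm_le (R : ℝ) : {α : Fin s → ℤ | ‖α‖ ≤ R}.Finite := by
  simpa only [Metric.closedBall, dist_zero_right] using
    (isCompact_closedBall (0 : Fin s → ℤ) R).finite_of_discrete

theorem locallyFinite_support_sub_realVec {E : Type*} [Zero E] {f : (Fin s → ℝ) → E}
    (hf : HasCompactSupport f) :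
    LocallyFinite fun α : Fin s → ℤ => Function.support fun x => f (x - realVec α) := by
  obtain ⟨R, -, hR⟩ := hf.exists_pos_le_norm
  refine fun x => ⟨Metric.ball x 1, Metric.ball_mem_nhds x one_pos,
    (finite_norm_le (R + (‖x‖ + 1))).subset ?_⟩
  rintro α ⟨y, hy, hyx⟩
  have hshift : ‖y - realVec α‖ < R := not_le.1 fun h => hy (hR _ h)
  have hnear : ‖y‖ < ‖x‖ + 1 := by
    linarith [norm_sub_norm_le y x, mem_ball_iff_norm.1 hyx]
  have hα : ‖realVec α‖ ≤ ‖y‖ + ‖y - realVec α‖ := norm_le_norm_add_norm_sub y _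
  rw [Set.mem_ofPred_eq, ← norm_realVec]
  linarith

/-! ### Periodization and the partition of unity -/

/-- The half-open unit cube `(0, 1]^s`, which is the domain of integration for Fourier
coefficients on the torus `UnitAddTorus (Fin s)`. -/
def unitCube (s : ℕ) : Set (Fin s → ℝ) := {x | ∀ i, x i ∈ Set.Ioc (0 : ℝ) (0 + 1)}

theorem measurableSet_unitCube : MeasurableSet (unitCube s) :=
  MeasurableSet.univ_pi' fun _ => measurableSet_Ioc

theorem existsUnique_sub_realVec_mem_unitCube (x : Fin s → ℝ) :
    ∃! α : Fin s → ℤ, x - realVec α ∈ unitCube s := by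
  choose n hn hn' using fun i => existsUnique_sub_zsmul_mem_Ioc (zero_lt_one' ℝ) (x i) 0
  simp only [zsmul_one] at hn hn'
  exact ⟨n, hn, fun α hα => funext fun i => hn' i (α i) (hα i)⟩

theorem hasSum_setIntegral_unitCube_sub_realVec {E : Type*} [NormedAddCommGroup E]
    [NormedSpace ℝ E] {h : (Fin s → ℝ) → E} (hh : Integrable h) :
    HasSum (fun α : Fin s → ℤ => ∫ x in unitCube s, h (x - realVec α)) (∫ x, h x) := by
  let tile (α : Fin s → ℤ) : Set (Fin s → ℝ) := (· + realVec α) ⁻¹' unitCube s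
  have mem_tile (α : Fin s → ℤ) (x : Fin s → ℝ) :
      x ∈ tile α ↔ x - realVec (-α) ∈ unitCube s := by
    rw [realVec_neg, sub_neg_eq_add, Set.mem_preimage]
  have tile_measurable (α : Fin s → ℤ) : MeasurableSet (tile α) :=
    measurable_add_const (realVec α) measurableSet_unitCube
  have tile_disjoint : Pairwise (Function.onFun Disjoint tile) := fun α β hne =>
    Set.disjoint_left.2 fun x hα hβ => hne <| neg_injective <|
      (existsUnique_sub_realVec_mem_unitCube x).unique ((mem_tile α x).1 hα) ((mem_tile β x).1 hβ)
  have tile_cover : ⋃ α, tile α = Set.univ := by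
    refine Set.eq_univ_of_forall fun x => ?_
    obtain ⟨α, hα, -⟩ := existsUnique_sub_realVec_mem_unitCube x
    exact Set.mem_iUnion.2 ⟨-α, (mem_tile _ x).2 (by rwa [neg_neg])⟩
  have hsum := hasSum_integral_iUnion tile_measurable tile_disjoint hh.integrableOn
  rw [tile_cover, setIntegral_univ] at hsum
  refine hsum.congr_fun fun α => ?_
  rw [← (measurePreserving_sub_right volume (realVec α)).setIntegral_preimage_emb
    (MeasurableEquiv.subRight (realVec α)).measurableEmbedding h (tile α)]
  simp [tile, Set.preimage_preimage]

theorem integral_eq_setIntegral_unitCube_tsum {E : Type*} [NormedAddCommGroup E]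
    [NormedSpace ℝ E] {h : (Fin s → ℝ) → E} (hh : Integrable h) :
    ∫ x, h x = ∫ x in unitCube s, ∑' α : Fin s → ℤ, h (x - realVec α) := by
  rw [← (hasSum_setIntegral_unitCube_sub_realVec hh).tsum_eq]
  exact integral_tsum_of_summable_integral_norm
    (fun α => (hh.comp_sub_right (realVec α)).integrableOn)
    (hasSum_setIntegral_unitCube_sub_realVec hh.norm).summable

theorem continuous_tsum_sub_realVec {E : Type*} [AddCommMonoid E] [TopologicalSpace E]
    [ContinuousAdd E] {f : (Fin s → ℝ) → E} (hc : Continuous f) (hf : HasCompactSupport f) :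
    Continuous fun x => ∑' α : Fin s → ℤ, f (x - realVec α) := by
  have hloc := locallyFinite_support_sub_realVec hf
  simp only [tsum_eq_finsum (hloc.point_finite _)]
  exact continuous_finsum (fun α => by fun_prop) hloc

theorem tsum_add_realVec_sub_realVec {E : Type*} [AddCommMonoid E] [TopologicalSpace E]
    (f : (Fin s → ℝ) → E) (x : Fin s → ℝ) (β : Fin s → ℤ) :
    ∑' α : Fin s → ℤ, f (x + realVec β - realVec α) = ∑' α : Fin s → ℤ, f (x - realVec α) := by
  rw [← (Equiv.addRight β).tsum_eq fun α : Fin s → ℤ => f (x + realVec β - realVec α)]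
  simp only [Equiv.coe_addRight, realVec_add, add_sub_add_right_eq_sub]

/-- The quotient map `ℝ^s → ℝ^s / ℤ^s`. -/
def toTorus (x : Fin s → ℝ) : UnitAddTorus (Fin s) := fun i => (x i : UnitAddCircle)

theorem isOpenQuotientMap_toTorus : IsOpenQuotientMap (toTorus : (Fin s → ℝ) → _) :=
  IsOpenQuotientMap.piMap fun _ : Fin s => QuotientAddGroup.isOpenQuotientMap_mk

theorem toTorus_eq_toTorus_iff {x y : Fin s → ℝ} :
    toTorus x = toTorus y ↔ ∃ α : Fin s → ℤ, y = x + realVec α := by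
  have hcoord (i : Fin s) : (x i : UnitAddCircle) = y i ↔ ∃ n : ℤ, y i = x i + n := by
    rw [QuotientAddGroup.eq, AddSubgroup.mem_zmultiples_iff]
    exact exists_congr fun n => by rw [zsmul_one, eq_neg_add_iff_add_eq, eq_comm]
  simp only [funext_iff, toTorus, hcoord, Classical.skolem, Pi.add_apply, realVec]

theorem mFourier_neg_toTorus (n : Fin s → ℤ) (x : Fin s → ℝ) :
    UnitAddTorus.mFourier (-n) (toTorus x)
      = Complex.exp (-(2 * (Real.pi : ℂ) * Complex.I * ((x ⬝ᵥ realVec n : ℝ) : ℂ))) := by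
  simp only [toTorus, UnitAddTorus.mFourier, ContinuousMap.coe_mk, fourier_coe_apply, dotProduct,
    realVec, ← Complex.exp_sum, Complex.ofReal_sum, Finset.mul_sum, ← Finset.sum_neg_distrib]
  congr 1
  refine Finset.sum_congr rfl fun i _ => ?_
  push_cast [Pi.neg_apply]
  ring

theorem mFourierCoeff_periodization {f : (Fin s → ℝ) → ℝ} (hf : Integrable f)
    {F : UnitAddTorus (Fin s) → ℂ}
    (hF : ∀ x, F (toTorus x) = ∑' α : Fin s → ℤ, (f (x - realVec α) : ℂ)) (n : Fin s → ℤ) :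
    UnitAddTorus.mFourierCoeff F n = fourier f (realVec n) := by
  have hmod : Integrable fun x => UnitAddTorus.mFourier (-n) (toTorus x) * (f x : ℂ) :=
    hf.ofReal.bdd_mul (c := 1) ((UnitAddTorus.mFourier (-n)).continuous.comp
      isOpenQuotientMap_toTorus.continuous).aestronglyMeasurable <| .of_forall fun x =>
        ((UnitAddTorus.mFourier (-n)).norm_coe_le_norm _).trans UnitAddTorus.mFourier_norm.le
  simp only [fourier, ← mFourier_neg_toTorus]
  rw [UnitAddTorus.mFourierCoeff_eq_integral _ n 0, integral_eq_setIntegral_unitCube_tsum hmod]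
  refine setIntegral_congr_fun measurableSet_unitCube fun x _ => ?_
  change UnitAddTorus.mFourier (-n) (toTorus x) • F (toTorus x) = _
  rw [hF, smul_eq_mul, ← tsum_mul_left]
  refine tsum_congr fun α => ?_
  rw [toTorus_eq_toTorus_iff.2 ⟨α, (sub_add_cancel x (realVec α)).symm⟩]

theorem IsTestFunction.tsum_sub_realVec_eq_one {f : (Fin s → ℝ) → ℝ} (hf : IsTestFunction f)
    (x : Fin s → ℝ) : ∑' α : Fin s → ℤ, f (x - realVec α) = 1 := by
  let P : C(Fin s → ℝ, ℂ) := ⟨fun x => ∑' α : Fin s → ℤ, (f (x - realVec α) : ℂ),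
    continuous_tsum_sub_realVec (f := fun x => (f x : ℂ))
      (Complex.continuous_ofReal.comp hf.continuous)
      (hf.hasCompactSupport.comp_left Complex.ofReal_zero)⟩
  let π : C(Fin s → ℝ, UnitAddTorus (Fin s)) := ⟨toTorus, isOpenQuotientMap_toTorus.continuous⟩
  have hP : Function.FactorsThrough P π := fun y z hyz => by
    obtain ⟨α, rfl⟩ := toTorus_eq_toTorus_iff.1 hyz
    exact (tsum_add_realVec_sub_realVec (fun x => (f x : ℂ)) y α).symm
  let F : C(UnitAddTorus (Fin s), ℂ) :=
    Topology.IsQuotientMap.lift (f := π) isOpenQuotientMap_toTorus.isQuotientMap P hP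
  have hF (y : Fin s → ℝ) : F (toTorus y) = P y :=
    DFunLike.congr_fun (Topology.IsQuotientMap.lift_comp (f := π)
      isOpenQuotientMap_toTorus.isQuotientMap P hP) y
  have hcoeff := mFourierCoeff_periodization
    (hf.continuous.integrable_of_hasCompactSupport hf.hasCompactSupport) hF
  have hcoeff_ne (n : Fin s → ℤ) (hn : n ≠ 0) : UnitAddTorus.mFourierCoeff F n = 0 := by
    rw [hcoeff, hf.fourier_lattice n hn]
  have hcoeff_zero : UnitAddTorus.mFourierCoeff F 0 = 1 := by
    rw [hcoeff, realVec_zero, hf.fourier_zero]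
  have hseries := UnitAddTorus.hasSum_mFourier_series_apply_of_summable
    (summable_of_ne_finset_zero (s := {0}) fun n hn => hcoeff_ne n (by simpa using hn)) (toTorus x)
  have heq := hseries.unique (hasSum_single 0 fun n hn => by rw [hcoeff_ne n hn, zero_smul])
  rw [hF, hcoeff_zero, UnitAddTorus.mFourier_zero, ContinuousMap.one_apply, one_smul] at heq
  exact_mod_cast (Complex.ofReal_tsum _).trans heq

/-! ### Coset sums of a mask -/

section CosetSums

/-- The cube `{0, …, N}^s` as a finite set. -/
noncomputable def cubeFinset (s N : ℕ) : Finset (Fin s → ℤ) := Finset.Icc 0 fun _ => (N : ℤ)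

theorem mem_cubeFinset {N : ℕ} {α : Fin s → ℤ} : α ∈ cubeFinset s N ↔ α ∈ cube s N := by
  simp only [cubeFinset, Finset.mem_Icc, cube, Set.mem_ofPred_eq, Pi.le_def, Pi.zero_apply]
  exact forall_and.symm

theorem Mask.SupportedIn.eq_zero {N : ℕ} {a : Mask s} (ha : a.SupportedIn N)
    {α : Fin s → ℤ} (hα : α ∉ cubeFinset s N) : a α = 0 :=
  ha α (mt mem_cubeFinset.2 hα)

theorem symbol_eq_sum {N : ℕ} {a : Mask s} (ha : a.SupportedIn N) (z : Fin s → ℂ) :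
    symbol a z = ∑ α ∈ cubeFinset s N, (a α : ℂ) * ∏ j, z j ^ α j :=
  tsum_eq_sum fun α hα => by rw [ha.eq_zero hα, Complex.ofReal_zero, zero_mul]

variable {M : Matrix (Fin s) (Fin s) ℤ}

theorem norm_eq_one_of_mem_Xi {z : Fin s → ℂ} (hz : z ∈ Xi M) (j : Fin s) : ‖z j‖ = 1 := by
  obtain ⟨ξ, rfl⟩ := hz
  simp [Complex.norm_exp]

theorem norm_symbol_le_sumRuleDefect {N : ℕ} {a : Mask s} (ha : a.SupportedIn N)
    {z : Fin s → ℂ} (hz : z ∈ Xi M \ {1}) : ‖symbol a z‖ ≤ sumRuleDefect M a := by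
  refine le_csSup ⟨∑ α ∈ cubeFinset s N, |a α|, ?_⟩ (Set.mem_image_of_mem _ hz)
  rintro _ ⟨w, hw, rfl⟩
  simp only [symbol_eq_sum ha]
  refine norm_sum_le_of_le _ fun α _ => le_of_eq ?_
  simp [norm_eq_one_of_mem_Xi hw.1]

theorem sumRuleDefect_nonneg (a : Mask s) : 0 ≤ sumRuleDefect M a :=
  Real.sSup_nonneg (Set.forall_mem_image.2 fun _ _ => norm_nonneg _)

theorem det_realMat (M : Matrix (Fin s) (Fin s) ℤ) : (realMat M).det = (M.det : ℝ) :=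
  ((Int.castRingHom ℝ).map_det M).symm

theorem isUnit_det_realMat (hM : M.det ≠ 0) : IsUnit (realMat M).det := by
  rw [det_realMat, isUnit_iff_ne_zero]
  exact_mod_cast hM

theorem exp_mem_Xi (hM : M.det ≠ 0) {t : Fin s → ℝ} {ξ : Fin s → ℤ}
    (h : (realMat M)ᵀ *ᵥ t = realVec ξ) :
    (fun j => Complex.exp (2 * (Real.pi : ℂ) * Complex.I * (t j : ℂ))) ∈ Xi M := by
  refine ⟨ξ, ?_⟩
  have hdet : IsUnit (realMat M)ᵀ.det := by
    rw [Matrix.det_transpose]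
    exact isUnit_det_realMat hM
  simp only [← h, Matrix.mulVec_mulVec, Matrix.nonsing_inv_mul _ hdet, Matrix.one_mulVec]

/-- The sublattice `M ℤ^s`. -/
def imageLattice (M : Matrix (Fin s) (Fin s) ℤ) : Submodule ℤ (Fin s → ℤ) :=
  LinearMap.range M.mulVecLin

theorem mkQ_eq_zero_iff {x : Fin s → ℤ} : (imageLattice M).mkQ x = 0 ↔ ∃ y, M *ᵥ y = x := by
  rw [Submodule.mkQ_apply, Submodule.Quotient.mk_eq_zero, imageLattice, LinearMap.mem_range]
  rfl

theorem card_quotient_imageLattice (hM : M.det ≠ 0) :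
    Nat.card ((Fin s → ℤ) ⧸ imageLattice M) = M.det.natAbs := by
  rw [← Submodule.natAbs_det_equiv (imageLattice M) (LinearEquiv.ofInjective M.mulVecLin
    (Matrix.mulVec_injective_of_det_ne_zero hM))]
  exact congrArg Int.natAbs (LinearMap.det_toLin' M)

theorem finite_quotient_imageLattice (hM : M.det ≠ 0) :
    Finite ((Fin s → ℤ) ⧸ imageLattice M) :=
  Nat.finite_of_card_ne_zero <| by
    rw [card_quotient_imageLattice hM]
    exact Int.natAbs_ne_zero.2 hM

/-- The point of `ℂ^s` whose monomials `z^α` are the values of a character of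
`ℤ^s / M ℤ^s`, namely its values on the standard basis. -/
noncomputable def charPoint (ψ : AddChar ((Fin s → ℤ) ⧸ imageLattice M) ℂ) : Fin s → ℂ :=
  fun j => ψ ((imageLattice M).mkQ (Pi.single j 1))

theorem prod_charPoint_zpow (ψ : AddChar ((Fin s → ℤ) ⧸ imageLattice M) ℂ) (x : Fin s → ℤ) :
    ∏ j, charPoint ψ j ^ x j = ψ ((imageLattice M).mkQ x) := by
  have hx : (imageLattice M).mkQ x = ∑ j, x j • (imageLattice M).mkQ (Pi.single j 1) := by
    simp only [← map_smul, ← map_sum]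
    exact congrArg _ (pi_eq_sum_univ' x)
  rw [hx]
  change _ = ψ.toMonoidHom (Multiplicative.ofAdd (∑ j : Fin s, _))
  rw [ofAdd_sum, map_prod]
  exact Finset.prod_congr rfl fun j _ => (AddChar.map_zsmul_eq_zpow ψ _ _).symm

theorem charPoint_zero : charPoint (0 : AddChar ((Fin s → ℤ) ⧸ imageLattice M) ℂ) = 1 := rfl

theorem charPoint_eq_one_iff {ψ : AddChar ((Fin s → ℤ) ⧸ imageLattice M) ℂ} :
    charPoint ψ = 1 ↔ ψ = 0 := by
  refine ⟨fun h => ?_, fun h => h ▸ charPoint_zero⟩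
  ext x
  obtain ⟨x, rfl⟩ := (imageLattice M).mkQ_surjective x
  rw [← prod_charPoint_zpow, h]
  simp

theorem exists_charPoint_eq_exp (hM : M.det ≠ 0)
    (ψ : AddChar ((Fin s → ℤ) ⧸ imageLattice M) ℂ) :
    ∃ t : Fin s → ℝ,
      charPoint ψ = fun j => Complex.exp (2 * (Real.pi : ℂ) * Complex.I * (t j : ℂ)) := by
  have := finite_quotient_imageLattice hM
  choose θ hθ using fun j => (Complex.norm_eq_one_iff _).1
    (AddChar.norm_apply ψ ((imageLattice M).mkQ (Pi.single j 1)))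
  refine ⟨fun j => θ j / (2 * Real.pi), funext fun j => ?_⟩
  rw [charPoint, ← hθ]
  congr 1
  have hπ : (Real.pi : ℂ) ≠ 0 := Complex.ofReal_ne_zero.2 Real.pi_ne_zero
  push_cast
  field_simp

theorem exists_transpose_mulVec_eq_realVec {ψ : AddChar ((Fin s → ℤ) ⧸ imageLattice M) ℂ}
    {t : Fin s → ℝ}
    (ht : charPoint ψ = fun j => Complex.exp (2 * (Real.pi : ℂ) * Complex.I * (t j : ℂ))) :
    ∃ ξ : Fin s → ℤ, (realMat M)ᵀ *ᵥ t = realVec ξ := by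
  have hint (i : Fin s) : ∃ n : ℤ, ∑ j, (M j i : ℝ) * t j = n := by
    have hone : ∏ j, charPoint ψ j ^ (M *ᵥ Pi.single i 1) j = 1 := by
      rw [prod_charPoint_zpow, mkQ_eq_zero_iff.2 ⟨_, rfl⟩, AddChar.map_zero_eq_one]
    simp only [Matrix.mulVec_single_one, Matrix.col_apply, ht, ← Complex.exp_int_mul,
      ← Complex.exp_sum, Complex.exp_eq_one_iff] at hone
    obtain ⟨n, hn⟩ := hone
    have hmul : (2 * Real.pi * Complex.I : ℂ) * ∑ j, (M j i : ℂ) * t j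
        = (2 * Real.pi * Complex.I) * n := by
      rw [Finset.mul_sum, mul_comm _ (n : ℂ), ← hn]
      exact Finset.sum_congr rfl fun j _ => by ring
    exact ⟨n, by exact_mod_cast mul_left_cancel₀ Complex.two_pi_I_ne_zero hmul⟩
  choose ξ hξ using hint
  exact ⟨ξ, funext hξ⟩

theorem charPoint_mem_Xi (hM : M.det ≠ 0) (ψ : AddChar ((Fin s → ℤ) ⧸ imageLattice M) ℂ) :
    charPoint ψ ∈ Xi M := by
  obtain ⟨t, ht⟩ := exists_charPoint_eq_exp hM ψ
  obtain ⟨ξ, hξ⟩ := exists_transpose_mulVec_eq_realVec ht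
  exact ht ▸ exp_mem_Xi hM hξ

open Classical in
theorem subdivision_one_eq_sum {N : ℕ} (hM : M.det ≠ 0) {a : Mask s} (ha : a.SupportedIn N)
    (y : Fin s → ℤ) :
    subdivision M a 1 y
      = ∑ α ∈ cubeFinset s N, if (imageLattice M).mkQ (α - y) = 0 then a α else 0 := by
  have hinj : Function.Injective fun β : Fin s → ℤ => y - M *ᵥ β :=
    sub_right_injective.comp (Matrix.mulVec_injective_of_det_ne_zero hM)
  rw [← tsum_eq_sum (L := .unconditional _)
    (f := fun α => if (imageLattice M).mkQ (α - y) = 0 then a α else 0)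
    fun α hα => by rw [ha.eq_zero hα, ite_self], ← hinj.tsum_eq]
  · refine tsum_congr fun β => ?_
    rw [Pi.one_apply, mul_one, if_pos (mkQ_eq_zero_iff.2 ⟨-β, by simp [Matrix.mulVec_neg]⟩)]
  · intro α hα
    obtain ⟨x, hx⟩ := mkQ_eq_zero_iff.1 (not_not.1 fun h => hα (if_neg h))
    exact ⟨-x, by simp [Matrix.mulVec_neg, hx]⟩

theorem card_mul_subdivision_one {N : ℕ} [Fintype ((Fin s → ℤ) ⧸ imageLattice M)]
    (hM : M.det ≠ 0) {a : Mask s} (ha : a.SupportedIn N) (y : Fin s → ℤ) :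
    (Fintype.card ((Fin s → ℤ) ⧸ imageLattice M) : ℂ) * (subdivision M a 1 y : ℂ)
      = ∑ ψ : AddChar ((Fin s → ℤ) ⧸ imageLattice M) ℂ,
          ψ ((imageLattice M).mkQ (-y)) * symbol a (charPoint ψ) := by
  classical
  have hterm (α : Fin s → ℤ) (ψ : AddChar ((Fin s → ℤ) ⧸ imageLattice M) ℂ) :
      ψ ((imageLattice M).mkQ (-y)) * ((a α : ℂ) * ψ ((imageLattice M).mkQ α))
        = (a α : ℂ) * ψ ((imageLattice M).mkQ (α - y)) := by
    rw [sub_eq_add_neg, map_add _ α, AddChar.map_add_eq_mul]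
    ring
  simp only [symbol_eq_sum ha, prod_charPoint_zpow, Finset.mul_sum, hterm]
  rw [Finset.sum_comm, subdivision_one_eq_sum hM ha, Complex.ofReal_sum, Finset.mul_sum]
  refine Finset.sum_congr rfl fun α _ => ?_
  rw [← Finset.mul_sum, AddChar.sum_apply_eq_ite]
  split_ifs <;> simp [mul_comm]

theorem norm_sum_erase_zero_le {N : ℕ} [Fintype ((Fin s → ℤ) ⧸ imageLattice M)]
    [DecidableEq (AddChar ((Fin s → ℤ) ⧸ imageLattice M) ℂ)]
    (hM : M.det ≠ 0) {a : Mask s} (ha : a.SupportedIn N) (x : (Fin s → ℤ) ⧸ imageLattice M) :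
    ‖∑ ψ ∈ (Finset.univ : Finset (AddChar ((Fin s → ℤ) ⧸ imageLattice M) ℂ)).erase 0,
        ψ x * symbol a (charPoint ψ)‖
      ≤ Fintype.card ((Fin s → ℤ) ⧸ imageLattice M) * sumRuleDefect M a := by
  calc _ ≤ ∑ _ψ ∈ (Finset.univ : Finset (AddChar ((Fin s → ℤ) ⧸ imageLattice M) ℂ)).erase 0,
        sumRuleDefect M a := by
        refine norm_sum_le_of_le _ fun ψ hψ => ?_
        rw [norm_mul, AddChar.norm_apply, one_mul]
        exact norm_symbol_le_sumRuleDefect ha ⟨charPoint_mem_Xi hM ψ,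
          mt charPoint_eq_one_iff.1 (Finset.ne_of_mem_erase hψ)⟩
    _ ≤ _ := by
        rw [Finset.sum_const, nsmul_eq_mul, ← AddChar.card_eq (α := (Fin s → ℤ) ⧸ imageLattice M)]
        gcongr
        exacts [sumRuleDefect_nonneg a, Finset.card_le_univ _]

theorem abs_subdivision_one_sub_one_le {N : ℕ} (hM : M.det ≠ 0) {a : Mask s}
    (ha : a.SupportedIn N) (y : Fin s → ℤ) :
    |subdivision M a 1 y - 1| ≤ normalizationDefect M a + sumRuleDefect M a := by
  classical
  have := finite_quotient_imageLattice hM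
  let _ : Fintype ((Fin s → ℤ) ⧸ imageLattice M) := Fintype.ofFinite _
  set m := Fintype.card ((Fin s → ℤ) ⧸ imageLattice M) with hm
  have hm_pos : (1 : ℝ) ≤ m := by exact_mod_cast Fintype.card_pos
  have hdet : ((|M.det| : ℤ) : ℂ) = m := by
    rw [hm, ← Nat.card_eq_fintype_card, card_quotient_imageLattice hM, Int.abs_eq_natAbs,
      Int.cast_natCast]
  have hinversion := card_mul_subdivision_one hM ha y
  rw [← Finset.add_sum_erase _ _ (Finset.mem_univ 0), charPoint_zero, AddChar.zero_apply,
    one_mul] at hinversion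
  refine le_of_mul_le_mul_left ?_ (zero_lt_one.trans_le hm_pos)
  calc (m : ℝ) * |subdivision M a 1 y - 1|
      = ‖(m : ℂ) * (subdivision M a 1 y : ℂ) - m‖ := by
        rw [← mul_sub_one, norm_mul, Complex.norm_natCast, ← Complex.ofReal_one,
          ← Complex.ofReal_sub, Complex.norm_real, Real.norm_eq_abs]
    _ ≤ normalizationDefect M a + m * sumRuleDefect M a := by
        rw [hinversion, add_sub_right_comm, normalizationDefect, hdet]
        exact norm_add_le_of_le le_rfl (norm_sum_erase_zero_le hM ha _)
    _ ≤ m * (normalizationDefect M a + sumRuleDefect M a) := by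
        rw [mul_add]
        gcongr
        exact le_mul_of_one_le_left (norm_nonneg _) hm_pos

end CosetSums

/-! ### The attractor absorbs finite sets of lattice points -/

section Attractor

theorem realVec_mulVec (M : Matrix (Fin s) (Fin s) ℤ) (α : Fin s → ℤ) :
    realVec (M *ᵥ α) = realMat M *ᵥ realVec α := by
  ext i
  simp [realVec, realMat, Matrix.mulVec, dotProduct]

theorem inv_mulVec_realVec_mulVec {M : Matrix (Fin s) (Fin s) ℤ} (hM : M.det ≠ 0)
    (α : Fin s → ℤ) : (realMat M)⁻¹ *ᵥ realVec (M *ᵥ α) = realVec α := by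
  rw [realVec_mulVec, Matrix.mulVec_mulVec, Matrix.nonsing_inv_mul _ (isUnit_det_realMat hM),
    Matrix.one_mulVec]

/-- The compact set `∑_{r ≥ 1} M^{-r} G`, the attractor of the contractions
`x ↦ M⁻¹ (g + x)`, `g ∈ G`; its lattice points form `indexSet`. -/
def attractor (M : Matrix (Fin s) (Fin s) ℤ) (G : Finset (Fin s → ℤ)) : Set (Fin s → ℝ) :=
  {x | ∃ g : ℕ → Fin s → ℤ, (∀ r, g r ∈ G) ∧
    HasSum (fun r => (realMat M)⁻¹ ^ (r + 1) *ᵥ realVec (g r)) x}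

variable {M : Matrix (Fin s) (Fin s) ℤ} {G : Finset (Fin s → ℤ)}

theorem mem_indexSet {hM : IsDilation M} {α : Fin s → ℤ} :
    α ∈ indexSet hM G ↔ realVec α ∈ attractor M G :=
  (attractorPoints_finite hM G).mem_toFinset

theorem inv_mulVec_add_mem_attractor {g : Fin s → ℤ} (hg : g ∈ G) {x : Fin s → ℝ}
    (hx : x ∈ attractor M G) : (realMat M)⁻¹ *ᵥ (realVec g + x) ∈ attractor M G := by
  obtain ⟨γ, hγ, hsum⟩ := hx
  refine ⟨fun r => Nat.casesOn r g γ, Nat.rec hg fun r _ => hγ r, ?_⟩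
  have hshift := hsum.mapL (LinearMap.toContinuousLinearMap ((realMat M)⁻¹).mulVecLin)
  rw [← hasSum_nat_add_iff' 1]
  simpa [pow_succ' _ (_ + 1), Matrix.mulVec_add] using hshift

theorem exists_summable_norm_le (hM : IsDilation M) (G : Finset (Fin s → ℤ)) :
    ∃ u : ℕ → ℝ, Summable u ∧ ∀ r, ∀ g ∈ G,
      ‖(realMat M)⁻¹ ^ (r + 1) *ᵥ realVec g‖ ≤ u r := by
  obtain ⟨u, hu, hub⟩ := summable_norm_inv_pow_mulVec hM
  obtain ⟨C, hC⟩ := G.finite_toSet.isBounded.exists_norm_le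
  exact ⟨fun r => |u r| * C, hu.abs.mul_right C, fun r g hg => (hub r _).trans
    (mul_le_mul (le_abs_self _) (hC g hg) (norm_nonneg _) (abs_nonneg _))⟩

theorem isCompact_attractor (hM : IsDilation M) (G : Finset (Fin s → ℤ)) :
    IsCompact (attractor M G) := by
  obtain ⟨u, hu, hub⟩ := exists_summable_norm_le hM G
  have hcont : Continuous fun g : ℕ → G =>
      ∑' r, (realMat M)⁻¹ ^ (r + 1) *ᵥ realVec (g r : Fin s → ℤ) := by
    refine continuous_tsum (fun r => ?_) hu fun r g => hub r _ (g r).2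
    exact (continuous_of_discreteTopology (f := fun α : G =>
      (realMat M)⁻¹ ^ (r + 1) *ᵥ realVec (α : Fin s → ℤ))).comp (continuous_apply r)
  convert isCompact_range hcont using 1
  ext x
  constructor
  · rintro ⟨g, hg, hx⟩
    exact ⟨fun r => ⟨g r, hg r⟩, hx.tsum_eq⟩
  · rintro ⟨g, rfl⟩
    exact ⟨fun r => g r, fun r => (g r).2,
      (Summable.of_norm_bounded hu fun r => hub r _ (g r).2).hasSum⟩

theorem attractor_nonempty (hM : IsDilation M) (hG : G.Nonempty) : (attractor M G).Nonempty := by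
  obtain ⟨g, hg⟩ := hG
  obtain ⟨u, hu, hub⟩ := exists_summable_norm_le hM G
  exact ⟨_, fun _ => g, fun _ => hg,
    (Summable.of_norm_bounded hu fun r => hub r g hg).hasSum⟩

theorem exists_forall_norm_inv_pow_mulVec_lt (hM : IsDilation M) (R : ℝ) {δ : ℝ} (hδ : 0 < δ) :
    ∃ n, ∀ v : Fin s → ℝ, ‖v‖ ≤ R → ‖(realMat M)⁻¹ ^ n *ᵥ v‖ < δ := by
  obtain ⟨u, hu, hub⟩ := summable_norm_inv_pow_mulVec hM
  have hlim : Tendsto (fun m => |u m| * R) atTop (𝓝 0) := by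
    simpa using hu.abs.tendsto_atTop_zero.mul_const R
  obtain ⟨m, hm⟩ := (hlim.eventually (gt_mem_nhds hδ)).exists
  refine ⟨m + 1, fun v hv => (hub m v).trans_lt (hm.trans_le' ?_)⟩
  gcongr
  exact le_abs_self _

theorem exists_pos_forall_notMem_indexSet_lt_dist (hM : IsDilation M) (G : Finset (Fin s → ℤ)) :
    ∃ δ > 0, ∀ x ∈ attractor M G, ∀ α ∉ indexSet hM G, δ < dist x (realVec α) := by
  obtain ⟨δ, hδ, hlt⟩ := Metric.exists_pos_forall_lt_edist (isCompact_attractor hM G)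
    (isometry_realVec.isClosedEmbedding.isClosedMap _
      (isClosed_discrete (indexSet hM G : Set (Fin s → ℤ))ᶜ)) (by
      rw [Set.disjoint_left]
      rintro _ hx ⟨α, hα, rfl⟩
      exact hα (mem_indexSet.2 hx))
  refine ⟨δ, hδ, fun x hx α hα => ?_⟩
  have := hlt x hx _ (Set.mem_image_of_mem _ hα)
  rwa [edist_nndist, ENNReal.coe_lt_coe] at this

/-- The lattice points `α = M⁻¹ (p + q - ε)` with `p ∈ P`, `q ∈ {0, …, N}^s` and `ε ∈ E`. The
value of `S_a c` at `ε + M x - p` depends only on the values `c (x - α)` for such `α`. -/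
def reach (M : Matrix (Fin s) (Fin s) ℤ) (N : ℕ) (E : Finset (Fin s → ℤ))
    (P : Set (Fin s → ℤ)) : Set (Fin s → ℤ) :=
  {α | ∃ p ∈ P, ∃ q ∈ cube s N, ∃ ε ∈ E, M *ᵥ α = p + q - ε}

variable {N : ℕ} {E : Finset (Fin s → ℤ)}

theorem realVec_eq_of_mulVec_eq (hM : M.det ≠ 0) {α p q ε : Fin s → ℤ}
    (h : M *ᵥ α = p + q - ε) :
    realVec α = (realMat M)⁻¹ *ᵥ (realVec (q - ε) + realVec p) := by
  rw [← inv_mulVec_realVec_mulVec hM α, h, ← realVec_add]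
  congr 2
  abel

theorem reach_indexSet_subset (hM : IsDilation M)
    (hG : ∀ α ∈ cube s N, ∀ ε ∈ E, α - ε ∈ G) :
    reach M N E (indexSet hM G) ⊆ indexSet hM G := by
  rintro α ⟨p, hp, q, hq, ε, hε, h⟩
  rw [Finset.mem_coe, mem_indexSet, realVec_eq_of_mulVec_eq hM.1 h]
  exact inv_mulVec_add_mem_attractor (hG q hq ε hε) (mem_indexSet.1 hp)

theorem exists_mem_attractor_of_mem_reach_iterate (hM : M.det ≠ 0)
    (hG : ∀ α ∈ cube s N, ∀ ε ∈ E, α - ε ∈ G) {x₀ : Fin s → ℝ} (hx₀ : x₀ ∈ attractor M G)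
    {P : Set (Fin s → ℤ)} {n : ℕ} {α : Fin s → ℤ} (hα : α ∈ (reach M N E)^[n] P) :
    ∃ p ∈ P, ∃ x ∈ attractor M G, realVec α - x = (realMat M)⁻¹ ^ n *ᵥ (realVec p - x₀) := by
  induction n generalizing α with
  | zero => exact ⟨α, hα, x₀, hx₀, by rw [pow_zero, Matrix.one_mulVec]⟩
  | succ n ih =>
    rw [Function.iterate_succ_apply'] at hα
    obtain ⟨p', hp', q, hq, ε, hε, h⟩ := hα
    obtain ⟨p, hp, x, hx, hexp⟩ := ih hp'
    refine ⟨p, hp, _, inv_mulVec_add_mem_attractor (hG q hq ε hε) hx, ?_⟩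
    rw [realVec_eq_of_mulVec_eq hM h, ← Matrix.mulVec_sub, add_sub_add_left_eq_sub, hexp,
      Matrix.mulVec_mulVec, ← pow_succ']

theorem exists_reach_iterate_subset (hM : IsDilation M)
    (hG : ∀ α ∈ cube s N, ∀ ε ∈ E, α - ε ∈ G) (hGne : G.Nonempty)
    {P : Set (Fin s → ℤ)} (hP : P.Finite) : ∃ n, (reach M N E)^[n] P ⊆ indexSet hM G := by
  obtain ⟨x₀, hx₀⟩ := attractor_nonempty hM hGne
  obtain ⟨δ, hδ, hsep⟩ := exists_pos_forall_notMem_indexSet_lt_dist hM G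
  obtain ⟨R, hR⟩ := (hP.image fun p => realVec p - x₀).isBounded.exists_norm_le
  obtain ⟨n, hn⟩ := exists_forall_norm_inv_pow_mulVec_lt hM R hδ
  refine ⟨n, fun α hα => of_not_not fun hαK => ?_⟩
  obtain ⟨p, hp, x, hx, hexp⟩ := exists_mem_attractor_of_mem_reach_iterate hM.1 hG hx₀ hα
  refine (hsep x hx α hαK).not_gt ?_
  rw [dist_comm, dist_eq_norm, hexp]
  exact hn _ (hR _ (Set.mem_image_of_mem _ hp))

end Attractor

/-! ### Adapted norms -/

section AdaptedNorm

theorem norm_list_prod_le_mul_pow {R : Type*} [NormedRing R] {𝓜 : Set R} {B : ℝ}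
    (hB : ∀ L ∈ 𝓜, ‖L‖ ≤ B) (l : List R) (hl : ∀ L ∈ l, L ∈ 𝓜) :
    ‖l.prod‖ ≤ ‖(1 : R)‖ * B ^ l.length := by
  induction l with
  | nil => simp
  | cons L l ih =>
    obtain ⟨hL, hl⟩ := List.forall_mem_cons.1 hl
    rw [List.prod_cons, List.length_cons, pow_succ', mul_left_comm]
    exact (norm_mul_le _ _).trans
      (mul_le_mul (hB L hL) (ih hl) (norm_nonneg _) ((norm_nonneg L).trans (hB L hL)))

theorem eventually_norm_list_prod_le_pow {R : Type*} [NormedRing R] {𝓜 : Set R} {q : NNReal}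
    (hq : jointSpectralRadius 𝓜 < q) :
    ∀ᶠ n in atTop, ∀ l : List R, l.length = n → (∀ L ∈ l, L ∈ 𝓜) →
      ‖l.prod‖ ≤ (q : ℝ) ^ n := by
  filter_upwards [eventually_lt_of_limsup_lt hq, eventually_gt_atTop 0] with n hn hn0
  rintro l rfl hl
  have hpow := ENNReal.rpow_le_rpow hn.le (Nat.cast_nonneg l.length)
  rw [one_div, ENNReal.rpow_inv_rpow (Nat.cast_ne_zero.2 hn0.ne'), ENNReal.rpow_natCast] at hpow
  have hle := (le_iSup (fun w : Fin l.length → 𝓜 => ‖(List.ofFn fun i => (w i : R)).prod‖ₑ)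
    fun i => ⟨l.get i, hl _ (l.get_mem i)⟩).trans hpow
  rw [List.ofFn_get, enorm_eq_nnnorm] at hle
  exact_mod_cast hle

theorem exists_norm_list_prod_le_mul_pow {R : Type*} [NormedRing R] {𝓜 : Set R} {B : ℝ}
    (hB : ∀ L ∈ 𝓜, ‖L‖ ≤ B) (h : jointSpectralRadius 𝓜 < 1) :
    ∃ (q : NNReal) (C : ℝ), 0 < q ∧ q < 1 ∧ ∀ l : List R, (∀ L ∈ l, L ∈ 𝓜) →
      ‖l.prod‖ ≤ C * q ^ l.length := by
  obtain ⟨q, hJq, hq1⟩ := ENNReal.lt_iff_exists_nnreal_btwn.1 h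
  have hq0 : 0 < q := ENNReal.coe_pos.1 (zero_le.trans_lt hJq)
  replace hq1 : q < 1 := by exact_mod_cast hq1
  obtain ⟨n, hn⟩ := eventually_atTop.1 (eventually_norm_list_prod_le_pow hJq)
  refine ⟨q, max 1 (‖(1 : R)‖ * max 1 B ^ n / q ^ n), hq0, hq1, fun l hl => ?_⟩
  obtain hlen | hlen := le_total n l.length
  · exact (hn _ hlen l rfl hl).trans
      (le_mul_of_one_le_left (by positivity) (le_max_left _ _))
  · calc ‖l.prod‖ ≤ ‖(1 : R)‖ * max 1 B ^ l.length :=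
          norm_list_prod_le_mul_pow (fun L hL => (hB L hL).trans (le_max_right _ _)) l hl
      _ ≤ ‖(1 : R)‖ * max 1 B ^ n := by
          gcongr
          exact le_max_left _ _
      _ = ‖(1 : R)‖ * max 1 B ^ n / q ^ n * q ^ n := by field_simp
      _ ≤ max 1 (‖(1 : R)‖ * max 1 B ^ n / q ^ n) * q ^ l.length := by
          gcongr ?_ * ?_
          · exact le_max_right _ _
          · exact pow_le_pow_of_le_one q.2 hq1.le hlen

variable {V : Type*} [NormedAddCommGroup V] [NormedSpace ℝ V]

/-- The seminorm `ν` is equivalent to the norm of `V`, with constants `1` and `C`, and every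
member of `𝓜` contracts it by the factor `q < 1`. -/
structure IsAdaptedNorm (𝓜 : Set (V →L[ℝ] V)) (ν : Seminorm ℝ V) (q C : ℝ) : Prop where
  factor_nonneg : 0 ≤ q
  factor_lt_one : q < 1
  const_nonneg : 0 ≤ C
  norm_le (v : V) : ‖v‖ ≤ ν v
  le_norm (v : V) : ν v ≤ C * ‖v‖
  apply_le {L : V →L[ℝ] V} (hL : L ∈ 𝓜) (v : V) : ν (L v) ≤ q * ν v

theorem exists_isAdaptedNorm {𝓜 : Set (V →L[ℝ] V)} {B : ℝ} (hB : ∀ L ∈ 𝓜, ‖L‖ ≤ B)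
    (h : jointSpectralRadius 𝓜 < 1) :
    ∃ (ν : Seminorm ℝ V) (q C : ℝ), IsAdaptedNorm 𝓜 ν q C := by
  obtain ⟨q, C, hq0, hq1, hC⟩ := exists_norm_list_prod_le_mul_pow hB h
  let words := {l : List (V →L[ℝ] V) // ∀ L ∈ l, L ∈ 𝓜}
  let empty : words := ⟨[], List.forall_mem_nil _⟩
  have : Nonempty words := ⟨empty⟩
  let p (l : words) : Seminorm ℝ V :=
    (q ^ l.1.length)⁻¹ • (normSeminorm ℝ V).comp (l.1.prod : V →ₗ[ℝ] V)
  have p_apply (l : words) (v : V) : p l v = ((q : ℝ) ^ l.1.length)⁻¹ * ‖l.1.prod v‖ := rfl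
  have p_le (l : words) (v : V) : p l v ≤ C * ‖v‖ := by
    rw [p_apply, inv_mul_le_iff₀ (by positivity), mul_left_comm, ← mul_assoc]
    exact l.1.prod.le_of_opNorm_le (hC l.1 l.2) v
  have bdd (v : V) : BddAbove (Set.range fun l => p l v) :=
    ⟨C * ‖v‖, Set.forall_mem_range.2 fun l => p_le l v⟩
  have sup_apply (v : V) : (⨆ l, p l) v = ⨆ l, p l v :=
    Seminorm.iSup_apply (Seminorm.bddAbove_range_iff.2 bdd)
  refine ⟨⨆ l, p l, q, C, q.2, hq1, ?_, fun v => ?_, fun v => ?_, fun {L} hL v => ?_⟩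
  · simpa using (norm_nonneg _).trans (hC [] (List.forall_mem_nil _))
  · rw [sup_apply]
    exact le_ciSup_of_le (bdd v) empty (by simp [p_apply, empty])
  · rw [sup_apply]
    exact ciSup_le fun l => p_le l v
  · rw [sup_apply, sup_apply]
    refine ciSup_le fun l => ?_
    let snoc : words := ⟨l.1 ++ [L], List.forall_mem_append.2 ⟨l.2, by simpa using hL⟩⟩
    calc p l (L v) = q * p snoc v := by
          simp only [p_apply, snoc, List.length_append, List.length_singleton, List.prod_append,
            List.prod_singleton, mul_apply_eq_comp]
          field_simp
          ring
      _ ≤ q * ⨆ l, p l v := by gcongr; exact le_ciSup (bdd v) snoc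

end AdaptedNorm

/-! ### The subdivision operator of a single mask -/

section Subdivision

variable {N : ℕ} {M : Matrix (Fin s) (Fin s) ℤ} {b : Mask s} {B : ℝ}

theorem exists_finset_subdivision_eq_sum (hM : M.det ≠ 0) (hb : b.SupportedIn N)
    (y : Fin s → ℤ) : ∃ T : Finset (Fin s → ℤ), T.card ≤ (cubeFinset s N).card ∧
      (∀ β ∈ T, y - M *ᵥ β ∈ cube s N) ∧
      ∀ c : (Fin s → ℤ) → ℝ, subdivision M b c y = ∑ β ∈ T, b (y - M *ᵥ β) * c β := by
  have hinj : Function.Injective fun β : Fin s → ℤ => y - M *ᵥ β :=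
    sub_right_injective.comp (Matrix.mulVec_injective_of_det_ne_zero hM)
  let T := (cubeFinset s N).preimage (fun β => y - M *ᵥ β) hinj.injOn
  have mem_T (β : Fin s → ℤ) : β ∈ T ↔ y - M *ᵥ β ∈ cube s N :=
    Finset.mem_preimage.trans mem_cubeFinset
  refine ⟨T, Finset.card_le_card_of_injOn (fun β => y - M *ᵥ β)
    (fun β hβ => mem_cubeFinset.2 ((mem_T β).1 hβ)) hinj.injOn, fun β => (mem_T β).1, fun c => ?_⟩
  exact tsum_eq_sum fun β hβ => by rw [hb _ (mt (mem_T β).2 hβ), zero_mul]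

theorem abs_subdivision_le (hM : M.det ≠ 0) (hb : b.SupportedIn N) (hB : ∀ α, |b α| ≤ B)
    {c : (Fin s → ℤ) → ℝ} {y : Fin s → ℤ} {H : ℝ} (hH0 : 0 ≤ H)
    (hH : ∀ β, y - M *ᵥ β ∈ cube s N → |c β| ≤ H) :
    |subdivision M b c y| ≤ (cubeFinset s N).card * (B * H) := by
  obtain ⟨T, hT, hTc, hsum⟩ := exists_finset_subdivision_eq_sum hM hb y
  have hB0 : 0 ≤ B := (abs_nonneg _).trans (hB 0)
  calc |subdivision M b c y| = |∑ β ∈ T, b (y - M *ᵥ β) * c β| := by rw [hsum]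
    _ ≤ ∑ β ∈ T, |b (y - M *ᵥ β) * c β| := Finset.abs_sum_le_sum_abs _ _
    _ ≤ T.card • (B * H) := Finset.sum_le_card_nsmul _ _ _ fun β hβ => by
        rw [abs_mul]
        exact mul_le_mul (hB _) (hH β (hTc β hβ)) (abs_nonneg _) hB0
    _ ≤ (cubeFinset s N).card * (B * H) := by rw [nsmul_eq_mul]; gcongr

theorem subdivision_sub_const (hM : M.det ≠ 0) (hb : b.SupportedIn N)
    (c : (Fin s → ℤ) → ℝ) (y : Fin s → ℤ) (r : ℝ) :
    subdivision M b (fun β => c β - r) y = subdivision M b c y - r * subdivision M b 1 y := by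
  obtain ⟨T, -, -, hsum⟩ := exists_finset_subdivision_eq_sum hM hb y
  simp only [hsum, mul_sub, Finset.sum_sub_distrib, Pi.one_apply, mul_one, Finset.sum_mul,
    mul_comm r]

theorem abs_subdivision_sub_le (hM : M.det ≠ 0) (hb : b.SupportedIn N) (hB : ∀ α, |b α| ≤ B)
    {τ : ℝ} {c : (Fin s → ℤ) → ℝ} {y : Fin s → ℤ} (hτ : |subdivision M b 1 y - 1| ≤ τ)
    {H r : ℝ} (hH0 : 0 ≤ H) (hH : ∀ β, y - M *ᵥ β ∈ cube s N → |c β - r| ≤ H) :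
    |subdivision M b c y - r| ≤ (cubeFinset s N).card * (B * H) + τ * |r| := by
  calc |subdivision M b c y - r|
      = |subdivision M b (fun β => c β - r) y + (subdivision M b 1 y - 1) * r| := by
        rw [subdivision_sub_const hM hb]
        ring_nf
    _ ≤ |subdivision M b (fun β => c β - r) y| + |subdivision M b 1 y - 1| * |r| := by
        rw [← abs_mul]
        exact abs_add_le _ _
    _ ≤ (cubeFinset s N).card * (B * H) + τ * |r| := by
        gcongr
        exact abs_subdivision_le hM hb hB hH0 hH

theorem subdivision_add_mulVec_sub (c : (Fin s → ℤ) → ℝ) (ε x β : Fin s → ℤ) :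
    subdivision M b c (ε + M *ᵥ x - β)
      = ∑' α : Fin s → ℤ, b (ε + M *ᵥ α - β) * c (x - α) := by
  rw [subdivision, ← (Equiv.subLeft x).tsum_eq]
  refine tsum_congr fun α => ?_
  rw [Equiv.subLeft_apply, Matrix.mulVec_sub]
  congr 2
  abel

end Subdivision

/-! ### Limit points -/

section LimitPoints

variable {N : ℕ} {M : Matrix (Fin s) (Fin s) ℤ} {b : ℕ → Mask s} {B : ℝ} {a : Mask s}

theorem supportedIn_of_mem_limitPoints (hb : ∀ k, (b k).SupportedIn N)
    (ha : a ∈ limitPoints b) : a.SupportedIn N := by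
  obtain ⟨φ, -, hlim⟩ := ha
  intro α hα
  exact tendsto_nhds_unique (tendsto_pi_nhds.1 hlim α)
    (tendsto_const_nhds.congr fun n => (hb (φ n) α hα).symm)

theorem abs_le_of_mem_limitPoints (hB : ∀ k α, |b k α| ≤ B) (ha : a ∈ limitPoints b)
    (α : Fin s → ℤ) : |a α| ≤ B := by
  obtain ⟨φ, -, hlim⟩ := ha
  exact le_of_tendsto' (tendsto_pi_nhds.1 hlim α).abs fun n => hB (φ n) α

theorem subdivision_one_of_mem_limitPoints (hM : M.det ≠ 0) (hb : ∀ k, (b k).SupportedIn N)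
    {τ : ℕ → ℝ} (hτ : Tendsto τ atTop (𝓝 0)) (hbτ : ∀ k y, |subdivision M (b k) 1 y - 1| ≤ τ k)
    (ha : a ∈ limitPoints b) (y : Fin s → ℤ) : subdivision M a 1 y = 1 := by
  have ha_supp := supportedIn_of_mem_limitPoints hb ha
  obtain ⟨φ, hφ, hlim⟩ := ha
  have to_a : Tendsto (fun n => subdivision M (b (φ n)) 1 y) atTop
      (𝓝 (subdivision M a 1 y)) := by
    simp only [subdivision_one_eq_sum hM (hb _), subdivision_one_eq_sum hM ha_supp]
    refine tendsto_finsetSum _ fun α _ => ?_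
    split_ifs
    exacts [tendsto_pi_nhds.1 hlim α, tendsto_const_nhds]
  have to_one : Tendsto (fun n => subdivision M (b (φ n)) 1 y) atTop (𝓝 1) :=
    tendsto_iff_norm_sub_tendsto_zero.2 (squeeze_zero (fun _ => norm_nonneg _)
      (fun n => hbτ (φ n) y) (hτ.comp hφ.tendsto_atTop))
  exact tendsto_nhds_unique to_a to_one

theorem exists_mem_limitPoints_tendsto_comp (hB : ∀ k α, |b k α| ≤ B) {φ : ℕ → ℕ}
    (hφ : StrictMono φ) :
    ∃ a ∈ limitPoints b, ∃ ψ : ℕ → ℕ, StrictMono ψ ∧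
      Tendsto (fun n => b (φ (ψ n))) atTop (𝓝 a) := by
  have hcomp : IsCompact (Set.univ.pi fun _ : Fin s → ℤ => Set.Icc (-B) B) :=
    isCompact_univ_pi fun _ => isCompact_Icc
  obtain ⟨a, -, ψ, hψ, hlim⟩ := hcomp.tendsto_subseq (x := fun n => b (φ n))
    fun n α _ => abs_le.1 (hB (φ n) α)
  exact ⟨a, ⟨φ ∘ ψ, hφ.comp hψ, hlim⟩, ψ, hψ, hlim⟩

theorem eventually_exists_mem_limitPoints_abs_sub_le (hb : ∀ k, (b k).SupportedIn N)
    (hB : ∀ k α, |b k α| ≤ B) {η : ℝ} (hη : 0 < η) :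
    ∀ᶠ k in atTop, ∃ a ∈ limitPoints b, ∀ α, |b k α - a α| ≤ η := by
  by_contra hcon
  obtain ⟨φ, hφ, hfar⟩ := extraction_of_frequently_atTop (not_eventually.1 hcon)
  obtain ⟨a, ha, ψ, -, hlim⟩ := exists_mem_limitPoints_tendsto_comp hB hφ
  have hnear : ∀ᶠ n in atTop, ∀ α ∈ cubeFinset s N, |b (φ (ψ n)) α - a α| < η :=
    (Filter.eventually_all_finset _).2 fun α _ =>
      (tendsto_pi_nhds.1 hlim α).eventually (eventually_abs_sub_lt (a α) hη)
  obtain ⟨n, hn⟩ := hnear.exists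
  refine hfar (ψ n) ⟨a, ha, fun α => ?_⟩
  by_cases hα : α ∈ cubeFinset s N
  · exact (hn α hα).le
  · rw [(hb _).eq_zero hα, (supportedIn_of_mem_limitPoints hb ha).eq_zero hα, sub_self, abs_zero]
    exact hη.le

end LimitPoints

/-! ### Windows and transition matrices -/

section Window

theorem abs_dotProduct_le_mul_card_mul_norm {ι : Type*} [Fintype ι] {u : ι → ℝ} {C : ℝ}
    (hu : ∀ i, |u i| ≤ C) (v : ι → ℝ) : |u ⬝ᵥ v| ≤ C * (Fintype.card ι * ‖v‖) := by
  calc |u ⬝ᵥ v| ≤ ∑ i, |u i * v i| := Finset.abs_sum_le_sum_abs _ _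
    _ ≤ Fintype.card ι • (C * ‖v‖) := Finset.sum_le_card_nsmul _ _ _ fun i _ => by
        rw [abs_mul]
        exact mul_le_mul (hu i) (norm_le_pi_norm v i) (abs_nonneg _) ((abs_nonneg _).trans (hu i))
    _ = C * (Fintype.card ι * ‖v‖) := by rw [nsmul_eq_mul, mul_left_comm]

theorem norm_mulVec_le_mul_card_mul_norm {ι κ : Type*} [Fintype ι] [Fintype κ] [Nonempty ι]
    {A : Matrix ι κ ℝ} {C : ℝ} (hA : ∀ i j, |A i j| ≤ C) (v : κ → ℝ) :
    ‖A *ᵥ v‖ ≤ C * (Fintype.card κ * ‖v‖) :=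
  (pi_norm_le_iff_of_nonempty _).2 fun i => abs_dotProduct_le_mul_card_mul_norm (hA i) v

variable {N : ℕ} {M : Matrix (Fin s) (Fin s) ℤ} {K E : Finset (Fin s → ℤ)} {a b : Mask s}
  {ε : Fin s → ℤ}

theorem mem_diffSpace {v : K → ℝ} : v ∈ diffSpace K ↔ 1 ⬝ᵥ v = 0 := by
  rw [one_dotProduct]
  rfl

/-- The values `c (x - β)`, `β ∈ K`, of the data `c` seen through `K` at the position `x`. The
reflection is the one for which transition matrices act on windows. -/
def window (K : Finset (Fin s → ℤ)) (c : (Fin s → ℤ) → ℝ) (x : Fin s → ℤ) : K → ℝ :=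
  fun β => c (x - β)

theorem window_subdivision (hK : reach M N E K ⊆ K) (hb : b.SupportedIn N) (hε : ε ∈ E)
    (c : (Fin s → ℤ) → ℝ) (x : Fin s → ℤ) :
    window K (subdivision M b c) (ε + M *ᵥ x) = window K c x ᵥ* transitionMatrix M K ε b := by
  ext β
  calc subdivision M b c (ε + M *ᵥ x - β)
      = ∑' α, b (ε + M *ᵥ α - β) * c (x - α) := subdivision_add_mulVec_sub ..
    _ = ∑ α ∈ K, b (ε + M *ᵥ α - β) * c (x - α) := tsum_eq_sum fun α hα => by
        rw [hb _ fun hmem => hα (hK ⟨β.1, β.2, _, hmem, ε, hε, by abel⟩), zero_mul]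
    _ = ∑ α : K, c (x - α) * b (ε + M *ᵥ α.1 - β) := by
        rw [← Finset.sum_coe_sort]
        exact Finset.sum_congr rfl fun α _ => mul_comm _ _

theorem window_subdivision_dotProduct (hK : reach M N E K ⊆ K) (hb : b.SupportedIn N)
    (hε : ε ∈ E) (c : (Fin s → ℤ) → ℝ) (x : Fin s → ℤ) (v : K → ℝ) :
    window K (subdivision M b c) (ε + M *ᵥ x) ⬝ᵥ v
      = window K c x ⬝ᵥ transitionMatrix M K ε b *ᵥ v := by
  rw [window_subdivision hK hb hε, Matrix.dotProduct_mulVec]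

theorem one_dotProduct_transitionMatrix_mulVec (hK : reach M N E K ⊆ K) (hb : b.SupportedIn N)
    (hε : ε ∈ E) (v : K → ℝ) :
    1 ⬝ᵥ transitionMatrix M K ε b *ᵥ v = window K (subdivision M b 1) ε ⬝ᵥ v := by
  have h := window_subdivision_dotProduct hK hb hε 1 0 v
  rw [Matrix.mulVec_zero, add_zero] at h
  exact h.symm

theorem exists_mem_restrictedFamily (hK : reach M N E K ⊆ K) (ha : a.SupportedIn N)
    (ha_one : subdivision M a 1 = 1) (hε : ε ∈ E) {A : Set (Mask s)} (haA : a ∈ A) :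
    ∃ L ∈ restrictedFamily M K E A, ∀ v : diffSpace K,
      (L v : K → ℝ) = transitionMatrix M K ε a *ᵥ (v : K → ℝ) := by
  have maps : ∀ v ∈ diffSpace K, (transitionMatrix M K ε a).mulVecLin v ∈ diffSpace K :=
    fun v hv => mem_diffSpace.2 <| by
      rw [Matrix.mulVecLin_apply, one_dotProduct_transitionMatrix_mulVec hK ha hε, ha_one]
      exact mem_diffSpace.1 hv
  let L := LinearMap.toContinuousLinearMap ((transitionMatrix M K ε a).mulVecLin.restrict maps)
  exact ⟨L, ⟨ε, hε, a, haA, fun _ => rfl⟩, fun _ => rfl⟩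

theorem norm_le_of_mem_restrictedFamily [Nonempty K] {A : Set (Mask s)} {B : ℝ}
    (hB : ∀ a ∈ A, ∀ α, |a α| ≤ B) {L : diffSpace K →L[ℝ] diffSpace K}
    (hL : L ∈ restrictedFamily M K E A) : ‖L‖ ≤ B * Fintype.card K := by
  obtain ⟨ε, -, a, ha, h⟩ := hL
  have hB0 : 0 ≤ B := (abs_nonneg _).trans (hB a ha 0)
  refine L.opNorm_le_bound (by positivity) fun v => ?_
  rw [mul_assoc, Submodule.coe_norm, h]
  exact norm_mulVec_le_mul_card_mul_norm (fun _ _ => hB a ha _) _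

variable {ν : Seminorm ℝ (diffSpace K)} {q Cν B η τ C D : ℝ} {c : (Fin s → ℤ) → ℝ}

/-- The data `c` are bounded by `C`, and the functionals which their windows induce on the
difference space are bounded by `D` with respect to `ν`. -/
structure WindowBounds (ν : Seminorm ℝ (diffSpace K)) (c : (Fin s → ℤ) → ℝ) (C D : ℝ) :
    Prop where
  nonneg : 0 ≤ D
  abs_le (x : Fin s → ℤ) : |c x| ≤ C
  abs_window_dotProduct_le (x : Fin s → ℤ) (v : diffSpace K) :
    |window K c x ⬝ᵥ (v : K → ℝ)| ≤ D * ν v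

theorem windowBounds_of_abs_le (hc : ∀ x, |c x| ≤ C) (hν : ∀ v, ‖v‖ ≤ ν v) :
    WindowBounds ν c C (C * Fintype.card K) where
  nonneg := mul_nonneg ((abs_nonneg _).trans (hc 0)) (Nat.cast_nonneg _)
  abs_le := hc
  abs_window_dotProduct_le x v := by
    have hC : 0 ≤ C := (abs_nonneg _).trans (hc 0)
    refine (abs_dotProduct_le_mul_card_mul_norm (fun _ => hc _) _).trans ?_
    rw [mul_assoc]
    gcongr
    exact hν v

namespace WindowBounds

theorem abs_window_dotProduct_le_add [Nonempty K] (hc : WindowBounds ν c C D)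
    (hν : ∀ v, ν v ≤ Cν * ‖v‖) (hCν : 0 ≤ Cν) (x : Fin s → ℤ) (w : K → ℝ) :
    |window K c x ⬝ᵥ w| ≤ Cν * ((1 + Fintype.card K) * ‖w‖) * D + C * |1 ⬝ᵥ w| := by
  classical
  let κ : K := Classical.arbitrary K
  let m := 1 ⬝ᵥ w
  have abs_m_le : |m| ≤ 1 * (Fintype.card K * ‖w‖) :=
    abs_dotProduct_le_mul_card_mul_norm (fun _ => by simp) w
  let w₀ : diffSpace K := ⟨w - Pi.single κ m, mem_diffSpace.2 <| by
    rw [dotProduct_sub, dotProduct_single, Pi.one_apply, one_mul, sub_self]⟩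
  have norm_w₀_le : ‖w₀‖ ≤ (1 + Fintype.card K) * ‖w‖ :=
    calc ‖w - Pi.single κ m‖ ≤ ‖w‖ + |m| :=
          (norm_sub_le _ _).trans_eq (by rw [Pi.norm_single, Real.norm_eq_abs])
      _ ≤ (1 + Fintype.card K) * ‖w‖ := by linarith
  calc |window K c x ⬝ᵥ w| = |window K c x ⬝ᵥ (w₀ : K → ℝ) + c (x - κ) * m| := by
        rw [dotProduct_sub, dotProduct_single, window, sub_add_cancel]
    _ ≤ D * ν w₀ + C * |m| := by
        refine (abs_add_le _ _).trans (add_le_add (hc.abs_window_dotProduct_le x w₀) ?_)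
        rw [abs_mul]
        gcongr
        exact hc.abs_le _
    _ ≤ Cν * ((1 + Fintype.card K) * ‖w‖) * D + C * |m| := by
        rw [mul_comm D]
        have := hc.nonneg
        gcongr
        exact (hν w₀).trans (by gcongr)

theorem abs_subdivision_le [Nonempty K] (hc : WindowBounds ν c C D)
    (hν : ∀ v, ν v ≤ Cν * ‖v‖) (hCν : 0 ≤ Cν) (hE : IsCosetReps M E) (hK : reach M N E K ⊆ K)
    (hb : b.SupportedIn N) (hB : ∀ α, |b α| ≤ B) (hτ : ∀ y, |subdivision M b 1 y - 1| ≤ τ)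
    (y : Fin s → ℤ) :
    |subdivision M b c y| ≤ (1 + τ) * C + Cν * ((1 + Fintype.card K) * B) * D := by
  classical
  let κ : K := Classical.arbitrary K
  obtain ⟨ε, ⟨hε, x, hx⟩, -⟩ := hE (y + κ)
  let w := transitionMatrix M K ε b *ᵥ Pi.single κ 1
  have norm_w_le : ‖w‖ ≤ B := (pi_norm_le_iff_of_nonempty _).2 fun α => by
    simp only [w, Matrix.mulVec_single_one]
    exact hB _
  have abs_sum_w_le : |1 ⬝ᵥ w| ≤ 1 + τ := by
    rw [one_dotProduct_transitionMatrix_mulVec hK hb hε, dotProduct_single_one]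
    have := abs_sub_abs_le_abs_sub (subdivision M b 1 (ε - κ)) 1
    rw [abs_one] at this
    exact (sub_le_iff_le_add'.1 this).trans (by gcongr; exact hτ _)
  have hC : 0 ≤ C := (abs_nonneg _).trans (hc.abs_le 0)
  have hD := hc.nonneg
  calc |subdivision M b c y|
      = |window K (subdivision M b c) (ε + M *ᵥ x) ⬝ᵥ Pi.single κ 1| := by
        rw [dotProduct_single_one, window, ← hx, add_sub_cancel_right]
    _ = |window K c x ⬝ᵥ w| := by rw [window_subdivision_dotProduct hK hb hε]
    _ ≤ Cν * ((1 + Fintype.card K) * ‖w‖) * D + C * |1 ⬝ᵥ w| :=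
        hc.abs_window_dotProduct_le_add hν hCν x w
    _ ≤ Cν * ((1 + Fintype.card K) * B) * D + C * (1 + τ) := by gcongr
    _ = (1 + τ) * C + Cν * ((1 + Fintype.card K) * B) * D := by ring

theorem abs_window_subdivision_dotProduct_le [Nonempty K] (hc : WindowBounds ν c C D)
    {A : Set (Mask s)} (hν : IsAdaptedNorm (restrictedFamily M K E A) ν q Cν)
    (hE : IsCosetReps M E) (hK : reach M N E K ⊆ K)
    (hb : b.SupportedIn N) (hτ : ∀ y, |subdivision M b 1 y - 1| ≤ τ)
    (ha : a.SupportedIn N) (ha_one : subdivision M a 1 = 1) (haA : a ∈ A)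
    (hη : ∀ α, |b α - a α| ≤ η) (y : Fin s → ℤ) (v : diffSpace K) :
    |window K (subdivision M b c) y ⬝ᵥ (v : K → ℝ)|
      ≤ ((q + Cν * ((1 + Fintype.card K) * (η * Fintype.card K))) * D
          + Fintype.card K * τ * C) * ν v := by
  obtain ⟨ε, ⟨hε, x, rfl⟩, -⟩ := hE y
  obtain ⟨L, hL, hLv⟩ := exists_mem_restrictedFamily hK ha ha_one hε haA
  let w := (transitionMatrix M K ε b - transitionMatrix M K ε a) *ᵥ (v : K → ℝ)
  have mulVec_eq : transitionMatrix M K ε b *ᵥ (v : K → ℝ) = L v + w := by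
    rw [hLv, ← Matrix.add_mulVec, add_sub_cancel]
  have norm_w_le : ‖w‖ ≤ η * (Fintype.card K * ‖v‖) :=
    norm_mulVec_le_mul_card_mul_norm (fun _ _ => hη _) _
  have abs_sum_w_le : |1 ⬝ᵥ w| ≤ τ * (Fintype.card K * ‖v‖) :=
    calc |1 ⬝ᵥ w| = |(window K (subdivision M b 1) ε - 1) ⬝ᵥ (v : K → ℝ)| := by
          rw [sub_dotProduct, ← one_dotProduct_transitionMatrix_mulVec hK hb hε, mulVec_eq,
            dotProduct_add, mem_diffSpace.1 (L v).2, mem_diffSpace.1 v.2, zero_add, sub_zero]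
      _ ≤ τ * (Fintype.card K * ‖v‖) :=
          abs_dotProduct_le_mul_card_mul_norm (fun _ => hτ _) _
  have hC : 0 ≤ C := (abs_nonneg _).trans (hc.abs_le 0)
  have hη0 : 0 ≤ η := (abs_nonneg _).trans (hη 0)
  have hτ0 : 0 ≤ τ := (abs_nonneg _).trans (hτ 0)
  have hCν := hν.const_nonneg
  have hD := hc.nonneg
  calc |window K (subdivision M b c) (ε + M *ᵥ x) ⬝ᵥ (v : K → ℝ)|
      = |window K c x ⬝ᵥ (L v : K → ℝ) + window K c x ⬝ᵥ w| := by
        rw [window_subdivision_dotProduct hK hb hε, mulVec_eq, dotProduct_add]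
    _ ≤ D * ν (L v) + (Cν * ((1 + Fintype.card K) * ‖w‖) * D + C * |1 ⬝ᵥ w|) :=
        (abs_add_le _ _).trans (add_le_add (hc.abs_window_dotProduct_le x _)
          (hc.abs_window_dotProduct_le_add hν.le_norm hCν x w))
    _ ≤ D * (q * ν v) + (Cν * ((1 + Fintype.card K) * (η * (Fintype.card K * ν v))) * D
          + C * (τ * (Fintype.card K * ν v))) := by
        have hv := hν.norm_le v
        gcongr
        · exact hν.apply_le hL v
        · exact norm_w_le.trans (by gcongr)
        · exact abs_sum_w_le.trans (by gcongr)
    _ = ((q + Cν * ((1 + Fintype.card K) * (η * Fintype.card K))) * D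
          + Fintype.card K * τ * C) * ν v := by ring

theorem abs_sub_le (hc : WindowBounds ν c C D) (hν : ∀ v, ν v ≤ Cν * ‖v‖) (hCν : 0 ≤ Cν)
    (x : Fin s → ℤ) (κ κ' : K) : |c (x - κ) - c (x - κ')| ≤ 2 * Cν * D := by
  classical
  let v : diffSpace K := ⟨Pi.single κ 1 - Pi.single κ' 1, mem_diffSpace.2 <| by
    rw [dotProduct_sub, dotProduct_single_one, dotProduct_single_one, Pi.one_apply,
      Pi.one_apply, sub_self]⟩
  have norm_v_le : ‖v‖ ≤ 2 :=
    calc ‖(Pi.single κ 1 - Pi.single κ' 1 : K → ℝ)‖ ≤ ‖(1 : ℝ)‖ + ‖(1 : ℝ)‖ :=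
          (norm_sub_le _ _).trans_eq (by rw [Pi.norm_single, Pi.norm_single])
      _ = 2 := by norm_num
  have hD := hc.nonneg
  calc |c (x - κ) - c (x - κ')| = |window K c x ⬝ᵥ (v : K → ℝ)| := by
        rw [dotProduct_sub, dotProduct_single_one, dotProduct_single_one, window, window]
    _ ≤ D * ν v := hc.abs_window_dotProduct_le x v
    _ ≤ D * (Cν * 2) := by
        gcongr
        exact (hν v).trans (by gcongr)
    _ = 2 * Cν * D := by ring

end WindowBounds

theorem windowBounds_subdivision [Nonempty K] {A : Set (Mask s)} (hc : WindowBounds ν c C D)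
    (hν : IsAdaptedNorm (restrictedFamily M K E A) ν q Cν) (hE : IsCosetReps M E)
    (hK : reach M N E K ⊆ K) (hb : b.SupportedIn N) (hB : ∀ α, |b α| ≤ B)
    (hτ : ∀ y, |subdivision M b 1 y - 1| ≤ τ) (ha : a.SupportedIn N)
    (ha_one : subdivision M a 1 = 1) (haA : a ∈ A) (hη : ∀ α, |b α - a α| ≤ η)
    (hηq : Cν * ((1 + Fintype.card K) * (η * Fintype.card K)) ≤ (1 - q) / 2) :
    WindowBounds ν (subdivision M b c) ((1 + τ) * C + Cν * ((1 + Fintype.card K) * B) * D)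
      ((1 + q) / 2 * D + Fintype.card K * τ * C) where
  nonneg := by
    have hC : 0 ≤ C := (abs_nonneg _).trans (hc.abs_le 0)
    have hτ0 : 0 ≤ τ := (abs_nonneg _).trans (hτ 0)
    have hq := hν.factor_nonneg
    have hD := hc.nonneg
    positivity
  abs_le := hc.abs_subdivision_le hν.le_norm hν.const_nonneg hE hK hb hB hτ
  abs_window_dotProduct_le y v := by
    refine (hc.abs_window_subdivision_dotProduct_le hν hE hK hb hτ ha ha_one haA hη y v).trans ?_
    have hD := hc.nonneg
    gcongr
    linarith

end Window

/-! ### Coupled recursions -/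

section Recursion

theorem exists_forall_le_of_le_one_add_mul {F τ : ℕ → ℝ} (hF0 : 0 ≤ F 0) (hτ : Summable τ)
    (hτ0 : ∀ k, 0 ≤ τ k) (hF : ∀ k, F (k + 1) ≤ (1 + τ k) * F k) : ∃ R, ∀ k, F k ≤ R := by
  refine ⟨F 0 * Real.exp (∑' k, τ k), fun k => ?_⟩
  have hFk := discrete_gronwall (b := 0) hF0 (fun k _ => by simpa using hF k)
    (fun k _ => hτ0 k) (fun _ _ => le_rfl) (Nat.zero_le k)
  simp only [Pi.zero_apply, Finset.sum_const_zero, add_zero] at hFk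
  refine hFk.trans ?_
  gcongr
  exact hτ.sum_le_tsum _ fun j _ => hτ0 j

theorem summable_of_succ_le_mul_add {D e : ℕ → ℝ} {q : ℝ} (hq : q < 1) (hD0 : ∀ k, 0 ≤ D k)
    (he0 : ∀ k, 0 ≤ e k) (he : Summable e) (hD : ∀ k, D (k + 1) ≤ q * D k + e k) :
    Summable D := by
  refine summable_of_sum_range_le (c := (D 0 + ∑' k, e k) / (1 - q)) hD0 fun n => ?_
  rw [le_div_iff₀ (sub_pos.2 hq)]
  have hsum : ∑ k ∈ Finset.range n, D k
      ≤ q * ∑ k ∈ Finset.range n, D k + ∑' k, e k + D 0 :=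
    calc ∑ k ∈ Finset.range n, D k ≤ ∑ k ∈ Finset.range (n + 1), D k := by
          rw [Finset.sum_range_succ]
          exact le_add_of_nonneg_right (hD0 n)
      _ = ∑ k ∈ Finset.range n, D (k + 1) + D 0 := Finset.sum_range_succ' D n
      _ ≤ ∑ k ∈ Finset.range n, (q * D k + e k) + D 0 := by
          gcongr
          exact hD _
      _ ≤ q * ∑ k ∈ Finset.range n, D k + ∑' k, e k + D 0 := by
          rw [Finset.sum_add_distrib, Finset.mul_sum]
          gcongr
          exact he.sum_le_tsum _ fun k _ => he0 k
  linarith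

theorem bounded_and_summable_of_coupled {C D τ : ℕ → ℝ} {q Λ Λ' : ℝ} (hq1 : q < 1)
    (hΛ : 0 ≤ Λ) (hΛ' : 0 ≤ Λ') (hτ0 : ∀ k, 0 ≤ τ k) (hτ : Summable τ)
    (hC0 : ∀ k, 0 ≤ C k) (hD0 : ∀ k, 0 ≤ D k)
    (hC : ∀ k, C (k + 1) ≤ (1 + τ k) * C k + Λ * D k)
    (hD : ∀ k, D (k + 1) ≤ q * D k + Λ' * τ k * C k) :
    (∃ R, ∀ k, C k ≤ R) ∧ Summable D := by
  have hq : 0 < 1 - q := sub_pos.2 hq1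
  -- The weight `β` solves `Λ + β q = β`, which makes `C + β D` almost nonincreasing.
  obtain ⟨β, hβ0, hβ⟩ : ∃ β, 0 ≤ β ∧ Λ + β * q = β :=
    ⟨Λ / (1 - q), by positivity, by field_simp; ring⟩
  obtain ⟨R, hR⟩ : ∃ R, ∀ k, C k + β * D k ≤ R := by
    refine exists_forall_le_of_le_one_add_mul (τ := fun k => (1 + β * Λ') * τ k)
      (add_nonneg (hC0 0) (mul_nonneg hβ0 (hD0 0))) (hτ.mul_left _)
      (fun k => mul_nonneg (by positivity) (hτ0 k)) fun k => ?_
    calc C (k + 1) + β * D (k + 1)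
        ≤ ((1 + τ k) * C k + Λ * D k) + β * (q * D k + Λ' * τ k * C k) := by
          gcongr
          exacts [hC k, hD k]
      _ = (1 + (1 + β * Λ') * τ k) * C k + (Λ + β * q) * D k := by ring
      _ = (1 + (1 + β * Λ') * τ k) * C k + β * D k := by rw [hβ]
      _ ≤ (1 + (1 + β * Λ') * τ k) * (C k + β * D k) := by
          have : 0 ≤ (1 + β * Λ') * τ k * (β * D k) :=
            mul_nonneg (mul_nonneg (by positivity) (hτ0 k)) (mul_nonneg hβ0 (hD0 k))
          linarith
  have hCR (k : ℕ) : C k ≤ R := (le_add_of_nonneg_right (mul_nonneg hβ0 (hD0 k))).trans (hR k)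
  refine ⟨⟨R, hCR⟩, summable_of_succ_le_mul_add (e := fun k => Λ' * τ k * R) hq1 hD0
    (fun k => mul_nonneg (mul_nonneg hΛ' (hτ0 k)) ((hC0 0).trans (hCR 0)))
    ((hτ.mul_left _).mul_right _) fun k => (hD k).trans ?_⟩
  have := mul_nonneg hΛ' (hτ0 k)
  gcongr
  exact hCR k

end Recursion

/-! ### Bounds for the iterates -/

section Iterate

variable {N : ℕ} {M : Matrix (Fin s) (Fin s) ℤ} {K E : Finset (Fin s → ℤ)} {b : ℕ → Mask s}
  {B : ℝ} {τ : ℕ → ℝ} {c : (Fin s → ℤ) → ℝ}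

/-- The masks `b k` are uniformly bounded, have supports in the cube `{0, …, N}^s`, and their
subdivision operators reproduce constants up to the summable errors `τ k`. -/
structure SchemeBounds (M : Matrix (Fin s) (Fin s) ℤ) (N : ℕ) (b : ℕ → Mask s) (B : ℝ)
    (τ : ℕ → ℝ) : Prop where
  supportedIn (k : ℕ) : (b k).SupportedIn N
  abs_le (k : ℕ) (α : Fin s → ℤ) : |b k α| ≤ B
  summable : Summable τ
  abs_subdivision_one_sub_one_le (k : ℕ) (y : Fin s → ℤ) : |subdivision M (b k) 1 y - 1| ≤ τ k

theorem ApproxSumRules.schemeBounds (h : ApproxSumRules M b) (hM : M.det ≠ 0)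
    (hb : ∀ k, (b k).SupportedIn N) (hB : ∀ k α, |b k α| ≤ B) :
    SchemeBounds M N b B fun k => normalizationDefect M (b k) + sumRuleDefect M (b k) where
  supportedIn := hb
  abs_le := hB
  summable := h.1.add h.2
  abs_subdivision_one_sub_one_le k := abs_subdivision_one_sub_one_le hM (hb k)

namespace SchemeBounds

theorem bound_nonneg (h : SchemeBounds M N b B τ) : 0 ≤ B := (abs_nonneg _).trans (h.abs_le 0 0)

theorem defect_nonneg (h : SchemeBounds M N b B τ) (k : ℕ) : 0 ≤ τ k :=
  (abs_nonneg _).trans (h.abs_subdivision_one_sub_one_le k 0)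

theorem comp_add_left (h : SchemeBounds M N b B τ) (n : ℕ) :
    SchemeBounds M N (fun k => b (n + k)) B fun k => τ (n + k) where
  supportedIn _ := h.supportedIn _
  abs_le _ := h.abs_le _
  summable := h.summable.comp_injective (add_right_injective n)
  abs_subdivision_one_sub_one_le _ := h.abs_subdivision_one_sub_one_le _

theorem isBoundedSeq_iterate (h : SchemeBounds M N b B τ) (hM : M.det ≠ 0)
    (hc : IsBoundedSeq c) (k : ℕ) : IsBoundedSeq (iterate M b c k) := by
  induction k with
  | zero => exact hc
  | succ k ih =>
    obtain ⟨C, hC⟩ := ih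
    exact ⟨_, fun α => abs_subdivision_le hM (h.supportedIn k) (h.abs_le k)
      ((abs_nonneg _).trans (hC 0)) fun β _ => hC β⟩

theorem eventually_exists_mem_limitPoints (h : SchemeBounds M N b B τ) (hM : M.det ≠ 0)
    {η : ℝ} (hη : 0 < η) :
    ∀ᶠ k in atTop, ∃ a ∈ limitPoints b, a.SupportedIn N ∧ subdivision M a 1 = 1 ∧
      ∀ α, |b k α - a α| ≤ η := by
  filter_upwards [eventually_exists_mem_limitPoints_abs_sub_le h.supportedIn h.abs_le hη]
    with k ⟨a, ha, hba⟩
  exact ⟨a, ha, supportedIn_of_mem_limitPoints h.supportedIn ha,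
    funext (subdivision_one_of_mem_limitPoints hM h.supportedIn
      h.summable.tendsto_atTop_zero h.abs_subdivision_one_sub_one_le ha), hba⟩

theorem exists_windowBounds_iterate [Nonempty K] {ν : Seminorm ℝ (diffSpace K)} {q Cν η : ℝ}
    {A : Set (Mask s)} (h : SchemeBounds M N b B τ) (hE : IsCosetReps M E)
    (hK : reach M N E K ⊆ K) (hν : IsAdaptedNorm (restrictedFamily M K E A) ν q Cν)
    (hA : ∀ k, ∃ a ∈ A, a.SupportedIn N ∧ subdivision M a 1 = 1 ∧ ∀ α, |b k α - a α| ≤ η)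
    (hηq : Cν * ((1 + Fintype.card K) * (η * Fintype.card K)) ≤ (1 - q) / 2)
    (hc : IsBoundedSeq c) :
    ∃ C D : ℕ → ℝ, (∀ k, WindowBounds ν (iterate M b c k) (C k) (D k)) ∧
      (∃ R, ∀ k, C k ≤ R) ∧ Summable D := by
  obtain ⟨C₀, hC₀⟩ := hc
  let X (k : ℕ) : ℝ × ℝ := Nat.rec (C₀, C₀ * Fintype.card K) (fun k p =>
    ((1 + τ k) * p.1 + Cν * ((1 + Fintype.card K) * B) * p.2,
      (1 + q) / 2 * p.2 + Fintype.card K * τ k * p.1)) k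
  have hX (k : ℕ) : WindowBounds ν (iterate M b c k) (X k).1 (X k).2 := by
    induction k with
    | zero => exact windowBounds_of_abs_le hC₀ hν.norm_le
    | succ k ih =>
      obtain ⟨a, haA, ha, ha_one, hba⟩ := hA k
      exact windowBounds_subdivision ih hν hE hK (h.supportedIn k) (h.abs_le k)
        (h.abs_subdivision_one_sub_one_le k) ha ha_one haA hba hηq
  have hB := h.bound_nonneg
  have hCν := hν.const_nonneg
  exact ⟨fun k => (X k).1, fun k => (X k).2, hX, bounded_and_summable_of_coupled
    (by linarith [hν.factor_lt_one]) (by positivity) (Nat.cast_nonneg _) h.defect_nonneg h.summable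
    (fun k => (abs_nonneg _).trans ((hX k).abs_le 0)) (fun k => (hX k).nonneg)
    (fun _ => le_rfl) (fun _ => le_rfl)⟩

end SchemeBounds

end Iterate

/-! ### Summable oscillation -/

section Oscillation

/-- The oscillations of the sequences `c k` over the windows `x - P`, `x ∈ ℤ^s`, are bounded by a
summable sequence. -/
def SummableOscillation (c : ℕ → (Fin s → ℤ) → ℝ) (P : Set (Fin s → ℤ)) : Prop :=
  ∃ u : ℕ → ℝ, Summable u ∧ ∀ k x, ∀ p ∈ P, ∀ p' ∈ P, |c k (x - p) - c k (x - p')| ≤ u k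

namespace SummableOscillation

variable {c : ℕ → (Fin s → ℤ) → ℝ} {P Q : Set (Fin s → ℤ)}

theorem mono (h : SummableOscillation c Q) (hPQ : P ⊆ Q) : SummableOscillation c P := by
  obtain ⟨u, hu, huc⟩ := h
  exact ⟨u, hu, fun k x p hp p' hp' => huc k x p (hPQ hp) p' (hPQ hp')⟩

theorem of_nat_add (hc : ∀ k, IsBoundedSeq (c k)) (n : ℕ)
    (h : SummableOscillation (fun k => c (n + k)) P) : SummableOscillation c P := by
  choose R hR using hc
  obtain ⟨u, hu, huc⟩ := h
  refine ⟨fun k => if k < n then R k + R k else u (k - n), ?_, fun k x p hp p' hp' => ?_⟩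
  · rw [← summable_nat_add_iff n]
    simpa using hu
  · dsimp only
    split_ifs with hk
    · exact (abs_sub _ _).trans (add_le_add (hR k _) (hR k _))
    · obtain ⟨j, rfl⟩ := Nat.exists_eq_add_of_le (not_lt.1 hk)
      rw [Nat.add_sub_cancel_left]
      exact huc j x p hp p' hp'

end SummableOscillation

theorem exists_forall_abs_le_of_nat_add {c : ℕ → (Fin s → ℤ) → ℝ} (hc : ∀ k, IsBoundedSeq (c k))
    (n : ℕ) (h : ∃ C, ∀ k x, |c (n + k) x| ≤ C) : ∃ C, ∀ k x, |c k x| ≤ C := by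
  choose R hR using hc
  obtain ⟨C, hC⟩ := h
  obtain ⟨R', hR'⟩ := ((Finset.range n).image R).exists_le
  refine ⟨max R' C, fun k x => ?_⟩
  obtain hk | hk := lt_or_ge k n
  · exact le_max_of_le_left
      ((hR k x).trans (hR' _ (Finset.mem_image_of_mem R (Finset.mem_range.2 hk))))
  · obtain ⟨j, rfl⟩ := Nat.exists_eq_add_of_le hk
    exact le_max_of_le_right (hC j x)

variable {N : ℕ} {M : Matrix (Fin s) (Fin s) ℤ} {E G : Finset (Fin s → ℤ)}
  {P : Set (Fin s → ℤ)} {B : ℝ}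

theorem nonempty_of_isCosetReps (hE : IsCosetReps M E)
    (hG : ∀ α ∈ cube s N, ∀ ε ∈ E, α - ε ∈ G) : G.Nonempty := by
  obtain ⟨ε, ⟨hε, -⟩, -⟩ := hE 0
  exact ⟨0 - ε, hG 0 (fun _ => ⟨le_rfl, Nat.cast_nonneg N⟩) ε hε⟩

theorem reach_nonempty (hE : IsCosetReps M E) (hP : P.Nonempty) : (reach M N E P).Nonempty := by
  obtain ⟨p, hp⟩ := hP
  obtain ⟨ε, ⟨hε, y, hy⟩, -⟩ := hE p
  exact ⟨y, p, hp, 0, fun _ => ⟨le_rfl, Nat.cast_nonneg N⟩, ε, hε,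
    by rw [add_zero, hy, add_sub_cancel_left]⟩

theorem indexSet_nonempty (hM : IsDilation M) (hE : IsCosetReps M E)
    (hG : ∀ α ∈ cube s N, ∀ ε ∈ E, α - ε ∈ G) : (indexSet hM G).Nonempty := by
  obtain ⟨n, hn⟩ := exists_reach_iterate_subset hM hG (nonempty_of_isCosetReps hE hG)
    (Set.finite_singleton 0)
  exact Finset.coe_nonempty.1 ((Function.Iterate.rec Set.Nonempty (Set.singleton_nonempty 0)
    (fun _ => reach_nonempty hE) n).mono hn)

theorem abs_subdivision_sub_subdivision_le (hM : M.det ≠ 0) (hE : IsCosetReps M E) {b : Mask s}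
    (hb : b.SupportedIn N) (hB : ∀ α, |b α| ≤ B) {τ : ℝ}
    (hτ : ∀ y, |subdivision M b 1 y - 1| ≤ τ) {c : (Fin s → ℤ) → ℝ} {C u : ℝ}
    (hC : ∀ x, |c x| ≤ C)
    (hu : ∀ x, ∀ α ∈ reach M N E P, ∀ α' ∈ reach M N E P, |c (x - α) - c (x - α')| ≤ u)
    (x : Fin s → ℤ) {p p' : Fin s → ℤ} (hp : p ∈ P) (hp' : p' ∈ P) :
    |subdivision M b c (x - p) - subdivision M b c (x - p')|
      ≤ 2 * ((cubeFinset s N).card * (B * u) + τ * C) := by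
  obtain ⟨ε, ⟨hε, x', rfl⟩, -⟩ := hE x
  obtain ⟨α₀, hα₀⟩ := reach_nonempty (N := N) hE ⟨p, hp⟩
  have hu0 : 0 ≤ u := (abs_nonneg _).trans (hu 0 α₀ hα₀ α₀ hα₀)
  have hτ0 : 0 ≤ τ := (abs_nonneg _).trans (hτ 0)
  have near {p : Fin s → ℤ} (hp : p ∈ P) :
      |subdivision M b c (ε + M *ᵥ x' - p) - c (x' - α₀)|
        ≤ (cubeFinset s N).card * (B * u) + τ * C := by
    refine (abs_subdivision_sub_le hM hb hB (hτ _) hu0 fun β hβ => ?_).trans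
      (add_le_add_right (mul_le_mul_of_nonneg_left (hC _) hτ0) _)
    have hβ' : x' - β ∈ reach M N E P :=
      ⟨p, hp, _, hβ, ε, hε, by rw [Matrix.mulVec_sub]; abel⟩
    simpa only [sub_sub_cancel] using hu x' _ hβ' α₀ hα₀
  rw [two_mul]
  exact (abs_sub_le _ (c (x' - α₀)) _).trans
    (add_le_add (near hp) ((abs_sub_comm _ _).trans_le (near hp')))

theorem iterate_add (M : Matrix (Fin s) (Fin s) ℤ) (b : ℕ → Mask s) (c : (Fin s → ℤ) → ℝ)
    (n k : ℕ) :
    iterate M b c (n + k) = iterate M (fun j => b (n + j)) (iterate M b c n) k := by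
  induction k with
  | zero => rfl
  | succ k ih => exact congrArg (subdivision M (b (n + k))) ih

namespace SchemeBounds

variable {b : ℕ → Mask s} {τ : ℕ → ℝ} {c : (Fin s → ℤ) → ℝ} {C : ℝ}

theorem summableOscillation_of_reach (h : SchemeBounds M N b B τ) (hM : M.det ≠ 0)
    (hE : IsCosetReps M E) (hC : ∀ k x, |iterate M b c k x| ≤ C)
    (hP : SummableOscillation (iterate M b c) (reach M N E P)) :
    SummableOscillation (iterate M b c) P := by
  obtain ⟨u, hu, huc⟩ := hP
  refine .of_nat_add (fun k => ⟨C, hC k⟩) 1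
    ⟨fun k => 2 * ((cubeFinset s N).card * (B * u k) + τ k * C),
      (((hu.mul_left B).mul_left _).add (h.summable.mul_right C)).mul_left 2,
      fun k x p hp p' hp' => ?_⟩
  simp only [add_comm 1 k]
  exact abs_subdivision_sub_subdivision_le hM hE (h.supportedIn k) (h.abs_le k)
    (h.abs_subdivision_one_sub_one_le k) (hC k) (huc k) x hp hp'

theorem summableOscillation_of_reach_iterate (h : SchemeBounds M N b B τ) (hM : M.det ≠ 0)
    (hE : IsCosetReps M E) (hC : ∀ k x, |iterate M b c k x| ≤ C) (n : ℕ)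
    (hP : SummableOscillation (iterate M b c) ((reach M N E)^[n] P)) :
    SummableOscillation (iterate M b c) P := by
  induction n with
  | zero => exact hP
  | succ n ih =>
    rw [Function.iterate_succ_apply'] at hP
    exact ih (h.summableOscillation_of_reach hM hE hC hP)

theorem exists_bound_and_summableOscillation_indexSet (h : SchemeBounds M N b B τ)
    (hM : IsDilation M) (hE : IsCosetReps M E) (hG : ∀ α ∈ cube s N, ∀ ε ∈ E, α - ε ∈ G)
    (hjsr : jointSpectralRadius (restrictedFamily M (indexSet hM G) E (limitPoints b)) < 1)
    (hc : IsBoundedSeq c) :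
    (∃ C, ∀ k x, |iterate M b c k x| ≤ C) ∧
      SummableOscillation (iterate M b c) (indexSet hM G) := by
  set K := indexSet hM G
  have : Nonempty K := (indexSet_nonempty hM hE hG).to_subtype
  obtain ⟨ν, q, Cν, hν⟩ := exists_isAdaptedNorm (fun L hL => norm_le_of_mem_restrictedFamily
    (fun a ha α => abs_le_of_mem_limitPoints h.abs_le ha α) hL) hjsr
  have hCν := hν.const_nonneg
  have hq : 0 < 1 - q := sub_pos.2 hν.factor_lt_one
  obtain ⟨η, hη, hηq⟩ :
      ∃ η > 0, Cν * ((1 + Fintype.card K) * Fintype.card K) * η < (1 - q) / 2 :=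
    exists_pos_mul_lt (half_pos hq) _
  obtain ⟨n, hn⟩ := eventually_atTop.1 (h.eventually_exists_mem_limitPoints hM.1 hη)
  have hbdd := h.isBoundedSeq_iterate hM.1 hc
  obtain ⟨C, D, hCD, ⟨R, hR⟩, hD⟩ := (h.comp_add_left n).exists_windowBounds_iterate hE
    (reach_indexSet_subset hM hG) hν (fun k => hn (n + k) (Nat.le_add_right n k))
    (by linarith) (hbdd n)
  simp only [← iterate_add] at hCD
  exact ⟨exists_forall_abs_le_of_nat_add hbdd n ⟨R, fun k x => ((hCD k).abs_le x).trans (hR k)⟩,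
    .of_nat_add hbdd n ⟨fun k => 2 * Cν * D k, hD.mul_left _, fun k x p hp p' hp' =>
      (hCD k).abs_sub_le hν.le_norm hCν x ⟨p, hp⟩ ⟨p', hp'⟩⟩⟩

theorem exists_bound_and_summableOscillation (h : SchemeBounds M N b B τ)
    (hM : IsDilation M) (hE : IsCosetReps M E) (hG : ∀ α ∈ cube s N, ∀ ε ∈ E, α - ε ∈ G)
    (hjsr : jointSpectralRadius (restrictedFamily M (indexSet hM G) E (limitPoints b)) < 1)
    (hc : IsBoundedSeq c) :
    (∃ C, ∀ k x, |iterate M b c k x| ≤ C) ∧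
      ∀ P : Set (Fin s → ℤ), P.Finite → SummableOscillation (iterate M b c) P := by
  obtain ⟨⟨C, hC⟩, hK⟩ := h.exists_bound_and_summableOscillation_indexSet hM hE hG hjsr hc
  refine ⟨⟨C, hC⟩, fun P hP => ?_⟩
  obtain ⟨n, hn⟩ := exists_reach_iterate_subset hM hG (nonempty_of_isCosetReps hE hG) hP
  exact h.summableOscillation_of_reach_iterate hM.1 hE hC n (hK.mono hn)

end SchemeBounds

theorem SummableOscillation.exists_abs_sub_le {c : ℕ → (Fin s → ℤ) → ℝ}
    (h : ∀ P : Set (Fin s → ℤ), P.Finite → SummableOscillation c P) (R : ℝ) :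
    ∃ u : ℕ → ℝ, Summable u ∧ ∀ k y z, ‖y - z‖ ≤ R → |c k y - c k z| ≤ u k := by
  obtain ⟨u, hu, huc⟩ := h _ ((finite_norm_le R).insert 0)
  refine ⟨u, hu, fun k y z hyz => ?_⟩
  simpa only [sub_zero, sub_sub_cancel] using
    huc k y 0 (Set.mem_insert _ _) (y - z) (Set.mem_insert_of_mem _ hyz)

end Oscillation

/-! ### Convergence -/

section UniformLimit

variable {X Y : Type*} [PseudoMetricSpace Y]

theorem exists_tendstoUniformly_of_summable_dist_le [CompleteSpace Y] {F : ℕ → X → Y}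
    {w : ℕ → ℝ} (hw : Summable w) (hF : ∀ k x, dist (F k x) (F (k + 1) x) ≤ w k) :
    ∃ g, TendstoUniformly F g atTop := by
  choose g hg using fun x => cauchySeq_tendsto_of_complete
    (cauchySeq_of_dist_le_of_summable w (fun k => hF k x) hw)
  refine ⟨g, Metric.tendstoUniformly_iff.2 fun ε hε => ?_⟩
  filter_upwards [(tendsto_sum_nat_add w).eventually (gt_mem_nhds hε)] with k hk x
  rw [dist_comm]
  refine (dist_le_tsum_of_dist_le_of_tendsto w (fun k => hF k x) hw (hg x) k).trans_lt ?_
  simpa only [add_comm k] using hk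

variable {ι : Type*} {l : Filter ι} {F H : ι → X → Y} {g : X → Y} {u : ι → ℝ}

theorem tendstoUniformly_of_dist_le (hF : TendstoUniformly F g l) (hu : Tendsto u l (𝓝 0))
    (hFH : ∀ k x, dist (F k x) (H k x) ≤ u k) : TendstoUniformly H g l := by
  rw [Metric.tendstoUniformly_iff] at hF ⊢
  intro ε hε
  filter_upwards [hF _ (half_pos hε), hu.eventually (gt_mem_nhds (half_pos hε))] with k hk huk x
  calc dist (g x) (H k x) ≤ dist (g x) (F k x) + dist (F k x) (H k x) := dist_triangle _ _ _
    _ < ε / 2 + ε / 2 := add_lt_add (hk x) ((hFH k x).trans_lt huk)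
    _ = ε := add_halves ε

theorem continuous_of_tendstoUniformly_of_eventually_dist_le [TopologicalSpace X] [l.NeBot]
    (hF : TendstoUniformly F g l) (hu : Tendsto u l (𝓝 0))
    (hFu : ∀ k x, ∀ᶠ y in 𝓝 x, dist (F k y) (F k x) ≤ u k) : Continuous g := by
  rw [Metric.continuous_iff']
  rw [Metric.tendstoUniformly_iff] at hF
  intro x ε hε
  have hε3 : 0 < ε / 3 := by positivity
  obtain ⟨k, hk, huk⟩ := ((hF _ hε3).and (hu.eventually (gt_mem_nhds hε3))).exists
  filter_upwards [hFu k x] with y hy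
  calc dist (g y) (g x)
      ≤ dist (g y) (F k y) + dist (F k y) (F k x) + dist (F k x) (g x) := dist_triangle4 _ _ _ _
    _ < ε / 3 + ε / 3 + ε / 3 :=
      add_lt_add (add_lt_add (hk y) (hy.trans_lt huk)) (dist_comm (g x) _ ▸ hk x)
    _ = ε := add_thirds ε

end UniformLimit

section Convergence

/-- The lattice point with coordinates `⌊x i⌋`; the data `c` are sampled at `x ∈ ℝ^s` as
`c (latticeFloor x)`. -/
noncomputable def latticeFloor (x : Fin s → ℝ) : Fin s → ℤ := fun i => ⌊x i⌋

theorem norm_sub_latticeFloor_le (x : Fin s → ℝ) : ‖x - realVec (latticeFloor x)‖ ≤ 1 := by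
  refine (pi_norm_le_iff_of_nonneg zero_le_one).2 fun i => ?_
  change ‖Int.fract (x i)‖ ≤ 1
  rw [Real.norm_of_nonneg (Int.fract_nonneg _)]
  exact (Int.fract_lt_one _).le

theorem norm_latticeFloor_sub_latticeFloor_le {x y : Fin s → ℝ} {r : ℝ} (h : ‖x - y‖ ≤ r) :
    ‖latticeFloor x - latticeFloor y‖ ≤ r + 2 := by
  have hsplit : realVec (latticeFloor x - latticeFloor y)
      = (x - y) - (x - realVec (latticeFloor x)) + (y - realVec (latticeFloor y)) := by
    rw [realVec_sub]
    abel
  rw [← norm_realVec, hsplit]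
  linarith [norm_add_le (x - y - (x - realVec (latticeFloor x))) (y - realVec (latticeFloor y)),
    norm_sub_le (x - y) (x - realVec (latticeFloor x)), norm_sub_latticeFloor_le x,
    norm_sub_latticeFloor_le y]

theorem norm_sub_latticeFloor_le_of_norm_sub_le {x : Fin s → ℝ} {α : Fin s → ℤ} {r : ℝ}
    (h : ‖x - realVec α‖ ≤ r) : ‖α - latticeFloor x‖ ≤ r + 1 := by
  rw [← norm_realVec, realVec_sub, ← sub_sub_sub_cancel_left _ _ x, norm_sub_rev]
  linarith [norm_sub_le (x - realVec α) (x - realVec (latticeFloor x)),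
    norm_sub_latticeFloor_le x]

theorem exists_abs_tsum_sub_le {f : (Fin s → ℝ) → ℝ} (hf : Continuous f)
    (hfs : HasCompactSupport f) (hf_one : ∀ x, ∑' α, f (x - realVec α) = 1) :
    ∃ R A : ℝ, ∀ (c : (Fin s → ℤ) → ℝ) (u : ℝ), (∀ y z, ‖y - z‖ ≤ R → |c y - c z| ≤ u) →
      ∀ x, |∑' α, c α * f (x - realVec α) - c (latticeFloor x)| ≤ A * u := by
  obtain ⟨R, -, hR⟩ := hfs.exists_pos_le_norm
  obtain ⟨F, hF⟩ := hf.bounded_above_of_compact_support hfs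
  have hF0 : 0 ≤ F := (norm_nonneg _).trans (hF 0)
  let T := (finite_norm_le (s := s) (R + 1)).toFinset
  refine ⟨R + 1, T.card * F, fun c u hc x => ?_⟩
  set z := latticeFloor x
  have hsupp (d : (Fin s → ℤ) → ℝ) : Summable fun α => d α * f (x - realVec α) :=
    summable_of_hasFiniteSupport (((locallyFinite_support_sub_realVec hfs).point_finite x).subset
      fun α hα => right_ne_zero_of_mul hα)
  have hfar : ∀ α ∉ T, f (x - realVec (z + α)) = 0 := fun α hα => by
    refine hR _ (le_of_not_gt fun hlt => hα ?_)
    simpa [T, z] using norm_sub_latticeFloor_le_of_norm_sub_le hlt.le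
  calc |∑' α, c α * f (x - realVec α) - c z|
      = |∑' α, (c α - c z) * f (x - realVec α)| := by
        simp only [sub_mul]
        rw [(hsupp c).tsum_sub (hsupp fun _ => c z), tsum_mul_left, hf_one, mul_one]
    _ = |∑ α ∈ T, (c (z + α) - c z) * f (x - realVec (z + α))| := by
        rw [← (Equiv.addLeft z).tsum_eq]
        congr 1
        exact tsum_eq_sum fun α hα => by rw [Equiv.coe_addLeft, hfar α hα, mul_zero]
    _ ≤ ∑ α ∈ T, |(c (z + α) - c z) * f (x - realVec (z + α))| := Finset.abs_sum_le_sum_abs _ _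
    _ ≤ ∑ _α ∈ T, F * u := by
        refine Finset.sum_le_sum fun α hα => ?_
        rw [abs_mul, mul_comm]
        refine mul_le_mul (hF _) (hc _ _ ?_) (abs_nonneg _) hF0
        simpa [T] using hα
    _ = T.card * F * u := by rw [Finset.sum_const, nsmul_eq_mul, mul_assoc]

variable {N : ℕ} {M : Matrix (Fin s) (Fin s) ℤ}

theorem exists_norm_sub_latticeFloor_le (hM : M.det ≠ 0) (N : ℕ) :
    ∃ R : ℝ, ∀ (x : Fin s → ℝ) (β : Fin s → ℤ),
      latticeFloor (realMat M *ᵥ x) - M *ᵥ β ∈ cube s N → ‖β - latticeFloor x‖ ≤ R := by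
  let Minv := LinearMap.toContinuousLinearMap ((realMat M)⁻¹).mulVecLin
  refine ⟨‖Minv‖ * (1 + N) + 1, fun x β hβ => norm_sub_latticeFloor_le_of_norm_sub_le ?_⟩
  set y := realMat M *ᵥ x
  set q := latticeFloor y - M *ᵥ β with hq
  have hq_norm : ‖realVec q‖ ≤ N := by
    rw [norm_realVec, pi_norm_le_iff_of_nonneg (Nat.cast_nonneg N)]
    intro i
    rw [Int.norm_eq_abs, abs_of_nonneg (by exact_mod_cast (hβ i).1)]
    exact_mod_cast (hβ i).2
  have hsplit : x - realVec β = Minv (y - realVec (latticeFloor y) + realVec q) := by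
    have hy : y - realVec (latticeFloor y) + realVec q = realMat M *ᵥ (x - realVec β) := by
      rw [hq, realVec_sub, realVec_mulVec, Matrix.mulVec_sub, sub_add_sub_cancel]
    rw [hy]
    simp only [Minv, LinearMap.coe_toContinuousLinearMap', Matrix.mulVecLin_apply]
    rw [Matrix.mulVec_mulVec, Matrix.nonsing_inv_mul _ (isUnit_det_realMat hM), Matrix.one_mulVec]
  rw [hsplit]
  exact Minv.le_opNorm_of_le ((norm_add_le _ _).trans
    (add_le_add (norm_sub_latticeFloor_le y) hq_norm))

variable {b : ℕ → Mask s} {B : ℝ} {τ : ℕ → ℝ} {c : (Fin s → ℤ) → ℝ}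

/-- The step function `x ↦ c_k(⌊M^k x⌋)` of the data `c_k` after `k` steps. -/
noncomputable def stepFunction (M : Matrix (Fin s) (Fin s) ℤ) (b : ℕ → Mask s)
    (c : (Fin s → ℤ) → ℝ) (k : ℕ) (x : Fin s → ℝ) : ℝ :=
  iterate M b c k (latticeFloor (realMat M ^ k *ᵥ x))

theorem exists_tendstoUniformly_stepFunction (h : SchemeBounds M N b B τ) (hM : M.det ≠ 0)
    {C : ℝ} (hC : ∀ k x, |iterate M b c k x| ≤ C)
    (hosc : ∀ P : Set (Fin s → ℤ), P.Finite → SummableOscillation (iterate M b c) P) :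
    ∃ g, TendstoUniformly (stepFunction M b c) g atTop := by
  obtain ⟨R, hR⟩ := exists_norm_sub_latticeFloor_le hM N
  obtain ⟨u, hu, huc⟩ := SummableOscillation.exists_abs_sub_le hosc R
  refine exists_tendstoUniformly_of_summable_dist_le
    (((hu.abs.mul_left B).mul_left ((cubeFinset s N).card : ℝ)).add (h.summable.mul_right C))
    fun k x => ?_
  rw [dist_comm, Real.dist_eq, stepFunction, pow_succ', ← Matrix.mulVec_mulVec]
  exact (abs_subdivision_sub_le hM (h.supportedIn k) (h.abs_le k)
    (h.abs_subdivision_one_sub_one_le k _) (abs_nonneg (u k))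
    fun β hβ => (huc k _ _ (hR _ β hβ)).trans (le_abs_self _)).trans
    (add_le_add_right (mul_le_mul_of_nonneg_left (hC k _) (h.defect_nonneg k)) _)

theorem continuous_of_tendstoUniformly_stepFunction
    (hosc : ∀ P : Set (Fin s → ℤ), P.Finite → SummableOscillation (iterate M b c) P)
    {g : (Fin s → ℝ) → ℝ} (hg : TendstoUniformly (stepFunction M b c) g atTop) :
    Continuous g := by
  obtain ⟨u, hu, huc⟩ := SummableOscillation.exists_abs_sub_le hosc (1 + 2)
  refine continuous_of_tendstoUniformly_of_eventually_dist_le hg hu.tendsto_atTop_zero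
    fun k x => ?_
  have hcont : Continuous fun y => realMat M ^ k *ᵥ y :=
    continuous_const.matrix_mulVec continuous_id
  filter_upwards [hcont.continuousAt.eventually (Metric.closedBall_mem_nhds _ one_pos)] with y hy
  exact huc k _ _ (norm_latticeFloor_sub_latticeFloor_le (mem_closedBall_iff_norm.1 hy))

theorem tendstoUniformly_tsum_of_stepFunction
    (hosc : ∀ P : Set (Fin s → ℤ), P.Finite → SummableOscillation (iterate M b c) P)
    {g : (Fin s → ℝ) → ℝ} (hg : TendstoUniformly (stepFunction M b c) g atTop)
    {f : (Fin s → ℝ) → ℝ} (hf : IsTestFunction f) :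
    TendstoUniformly
      (fun k x => ∑' α, iterate M b c k α * f (realMat M ^ k *ᵥ x - realVec α)) g atTop := by
  obtain ⟨R, A, hRA⟩ :=
    exists_abs_tsum_sub_le hf.continuous hf.hasCompactSupport hf.tsum_sub_realVec_eq_one
  obtain ⟨u, hu, huc⟩ := SummableOscillation.exists_abs_sub_le hosc R
  refine tendstoUniformly_of_dist_le hg (hu.mul_left A).tendsto_atTop_zero fun k x => ?_
  rw [dist_comm]
  exact hRA _ _ (huc k) _

end Convergence

end NonstationarySubdivision

open NonstationarySubdivision in
theorem corollary2_general {s N : ℕ} {M : Matrix (Fin s) (Fin s) ℤ} (hM : IsDilation M)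
    {E : Finset (Fin s → ℤ)} (hE : IsCosetReps M E) {G : Finset (Fin s → ℤ)}
    (hG : ∀ α ∈ cube s N, ∀ ε ∈ E, α - ε ∈ G) {b : ℕ → Mask s} (hb : ∀ k, (b k).SupportedIn N)
    (hb_bdd : ∃ C : ℝ, ∀ k α, |b k α| ≤ C)
    (hb_jsr : jointSpectralRadius (restrictedFamily M (indexSet hM G) E (limitPoints b)) < 1)
    (hb_sum : ApproxSumRules M b) : C0Convergent M b := by
  obtain ⟨B, hB⟩ := hb_bdd
  have h := hb_sum.schemeBounds hM.1 hb hB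
  intro c hc
  obtain ⟨⟨C, hC⟩, hosc⟩ := h.exists_bound_and_summableOscillation hM hE hG hb_jsr hc
  obtain ⟨g, hg⟩ := exists_tendstoUniformly_stepFunction h hM.1 hC hosc
  exact ⟨g, continuous_of_tendstoUniformly_stepFunction hosc hg,
    fun f hf => tendstoUniformly_tsum_of_stepFunction hosc hg hf⟩

open NonstationarySubdivision in
theorem corollary2 {s : ℕ} (hs : 0 < s) (N : ℕ)
    (M : Matrix (Fin s) (Fin s) ℤ) (hM : IsDilation M)
    (E : Finset (Fin s → ℤ)) (hE : IsCosetReps M E)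
    (G : Finset (Fin s → ℤ)) (hG : ∀ α ∈ cube s N, ∀ ε ∈ E, α - ε ∈ G)
    (a b : ℕ → Mask s)
    (ha : ∀ k, (a k).SupportedIn N) (hb : ∀ k, (b k).SupportedIn N)
    (hb_bdd : ∃ C : ℝ, ∀ k α, |b k α| ≤ C)
    (ha_conv : C0Convergent M a)
    (ha_jsr : jointSpectralRadius
      (restrictedFamily M (indexSet hM G) E (limitPoints a)) < 1)
    (hab : AsymptoticallySimilar a b)
    (hb_sum : ApproxSumRules M b) :
    C0Convergent M b := by
  rw [AsymptoticallySimilar] at hab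
  exact corollary2_general hM hE hG hb hb_bdd (hab ▸ ha_jsr) hb_sum
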